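/- Let $X\subset\mathbb{P}^3$ be a smooth quartic surface over $\mathbb{C}$, and let $l',l''$ be two disjoint lines contained in $X$. A \emph{symmetry} of $X$ is an automorphism $\tau\colon X\to X$ that is the restriction of an automorphism of $\mathbb{P}^3$ (an element of $\mathrm{PGL}_4(\mathbb{C})$), which is denoted by the same letter. It is \emph{symplectic} if it acts trivially on $H^{2,0}(X)$, the space of holomorphic $2$-forms on $X$. Write $\mathrm{Fix}(\tau,X)$ and $\mathrm{Fix}(\tau,\mathbb{P}^3)$ for the sets of fixed points of $\tau$ in $X$ and in $\mathbb{P}^3$. Then the following conditions are equivalent: (a) $l'$ and $l''$ are twin lines, i.e. there exist $10$ other distinct lines contained in $X$, each of which intersects both $l'$ and $l''$; (b) there exists a non-symplectic symmetry $\tau\colon X\to X$ of order $2$ such that $\mathrm{Fix}(\tau,X)=\mathrm{Fix}(\tau,\mathbb{P}^3)=l'\cup l''$. -/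

import Mathlib

open MvPolynomial
open scoped LinearAlgebra.Projectivization

noncomputable section

/-- The vector space `ℂ⁴` of homogeneous coordinates. -/
abbrev Vec4 : Type := Fin 4 → ℂ

/-- Complex projective space `ℙ³`. -/
abbrev P3 : Type := ℙ ℂ Vec4

/-- The automorphism group `PGL₄(ℂ)` of `ℙ³`: the permutations of `ℙ³` that are induced by an
invertible linear map of `ℂ⁴`. -/
def AutP3 : Subgroup (Equiv.Perm P3) :=
  (MulAction.toPermHom (Vec4 ≃ₗ[ℂ] Vec4) P3).range

/-- A line in `ℙ³`: the set of points lying in a two-dimensional subspace of `ℂ⁴`. -/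
def IsLine (l : Set P3) : Prop :=
  ∃ L : Submodule ℂ Vec4, Module.finrank ℂ L = 2 ∧ l = {p | p.submodule ≤ L}

/-- The differential at `v` of a polynomial function on `ℂ⁴`. -/
def polyDiff (F : MvPolynomial (Fin 4) ℂ) (v : Vec4) : Vec4 →ₗ[ℂ] ℂ :=
  ∑ i, eval v (pderiv i F) • LinearMap.proj i

/-- A smooth quartic surface in `ℙ³`, given by its equation: a quartic form whose partial
derivatives have no common zero on the surface. -/
structure SmoothQuartic where
  /-- The equation. -/
  poly : MvPolynomial (Fin 4) ℂ
  homogeneous : poly.IsHomogeneous 4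
  smooth : ∀ v : Vec4, v ≠ 0 → eval v poly = 0 → ∃ i, eval v (pderiv i poly) ≠ 0

theorem hasStrictFDerivAt_eval (F : MvPolynomial (Fin 4) ℂ) (v : Vec4) :
    HasStrictFDerivAt (fun x : Vec4 => eval x F)
      (LinearMap.toContinuousLinearMap (polyDiff F v)) v := by
  induction F using MvPolynomial.induction_on with
  | C a =>
    have h : LinearMap.toContinuousLinearMap (polyDiff (C a) v) = 0 := by
      ext w; simp [polyDiff]
    rw [h]
    simpa using hasStrictFDerivAt_const (𝕜 := ℂ) a v
  | add p q hp hq =>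
    have h : LinearMap.toContinuousLinearMap (polyDiff (p + q) v) =
        LinearMap.toContinuousLinearMap (polyDiff p v) +
        LinearMap.toContinuousLinearMap (polyDiff q v) := by
      ext w; simp [polyDiff, add_mul, Finset.sum_add_distrib]
    rw [h]
    have h2 : (fun x : Vec4 => eval x (p + q)) = (fun x => eval x p) + fun x => eval x q := by
      ext x; simp
    rw [h2]
    exact hp.add hq
  | mul_X p i hp =>
    have hi : HasStrictFDerivAt (fun x : Vec4 => x i)
        (ContinuousLinearMap.proj (R := ℂ) i : Vec4 →L[ℂ] ℂ) v :=
      (ContinuousLinearMap.proj (R := ℂ) i : Vec4 →L[ℂ] ℂ).hasStrictFDerivAt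
    have h : LinearMap.toContinuousLinearMap (polyDiff (p * X i) v) =
        eval v p • (ContinuousLinearMap.proj (R := ℂ) i : Vec4 →L[ℂ] ℂ) +
        v i • LinearMap.toContinuousLinearMap (polyDiff p v) := by
      ext w
      simp [polyDiff, pderiv_X, Pi.single_apply, add_mul, Finset.sum_add_distrib,
        Finset.mul_sum, apply_ite, mul_assoc]
    rw [h]
    have h2 : (fun x : Vec4 => eval x (p * X i)) = (fun x => eval x p) * fun x => x i := by
      ext x; simp
    rw [h2]
    exact hp.mul hi

theorem eval_smul_of_isHomogeneous {F : MvPolynomial (Fin 4) ℂ} {n : ℕ} (hF : F.IsHomogeneous n)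
    (c : ℂ) (v : Vec4) : eval (c • v) F = c ^ n * eval v F := by
  rw [eval_eq, eval_eq, Finset.mul_sum]
  refine Finset.sum_congr rfl fun d hd => ?_
  have hdeg : ∑ i ∈ d.support, d i = n := by
    rw [← hF (mem_support_iff.1 hd), Finsupp.weight_apply, Finsupp.sum]
    simp
  have : ∏ i ∈ d.support, (c • v) i ^ d i = c ^ n * ∏ i ∈ d.support, v i ^ d i := by
    simp [mul_pow, Finset.prod_mul_distrib, Finset.prod_pow_eq_pow_sum, hdeg]
  rw [this]
  ring

namespace SmoothQuartic

variable (X : SmoothQuartic)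

/-- The set of points of the surface `X` in `ℙ³`. -/
def surface : Set P3 := {p | eval p.rep X.poly = 0}

/-- The punctured affine cone over `X` in `ℂ⁴`. -/
def cone : Set Vec4 := {v | v ≠ 0 ∧ eval v X.poly = 0}

/-- The tangent space at `v` of the punctured affine cone over `X`. -/
def tangent (v : Vec4) : Submodule ℂ Vec4 := LinearMap.ker (polyDiff X.poly v)

theorem mk_mem_surface {v : Vec4} (hv : v ≠ 0) :
    Projectivization.mk ℂ v hv ∈ X.surface ↔ v ∈ X.cone := by
  obtain ⟨a, ha⟩ := Projectivization.exists_smul_eq_mk_rep ℂ v hv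
  have : eval (Projectivization.mk ℂ v hv).rep X.poly = (a : ℂ) ^ 4 * eval v X.poly := by
    rw [← ha]; exact eval_smul_of_isHomogeneous X.homogeneous _ _
  simp [surface, cone, this, hv]

/-- A linear map that preserves the punctured cone over `X` maps its tangent spaces to its
tangent spaces. -/
theorem map_mem_tangent (A : Vec4 ≃ₗ[ℂ] Vec4) (hA : ∀ v ∈ X.cone, A v ∈ X.cone)
    {v : Vec4} (hv : v ∈ X.cone) {w : Vec4} (hw : w ∈ X.tangent v) :
    A w ∈ X.tangent (A v) := by
  set A' : Vec4 →L[ℂ] Vec4 := LinearMap.toContinuousLinearMap A.toLinearMap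
  set f' := LinearMap.toContinuousLinearMap (polyDiff X.poly v)
  set g' := (LinearMap.toContinuousLinearMap (polyDiff X.poly (A v))).comp A'
  have hf : HasStrictFDerivAt (fun x : Vec4 => eval x X.poly) f' v :=
    hasStrictFDerivAt_eval _ _
  have hg : HasStrictFDerivAt (fun x : Vec4 => eval (A x) X.poly) g' v :=
    (hasStrictFDerivAt_eval X.poly (A' v)).comp v A'.hasStrictFDerivAt
  have hw' : f' w = 0 := hw
  change g' w = 0
  by_contra hgw
  obtain ⟨i, hi⟩ := X.smooth v hv.1 hv.2
  have hu : f' (Pi.single i 1) ≠ 0 := by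
    simpa [f', polyDiff, Pi.single_apply] using hi
  set u : Vec4 := Pi.single i 1
  have hsurj : (f'.prod g').range = ⊤ := by
    rw [LinearMap.range_eq_top]
    rintro ⟨a, b⟩
    refine ⟨(a / f' u) • u + ((b - a / f' u * g' u) / g' w) • w, ?_⟩
    ext
    · simp [hw', hu]
    · simp [hgw]
  have hmap := (hf.prodMk hg).map_nhds_eq_of_surj hsurj
  have h0 : eval v X.poly = 0 := hv.2
  have h1 : eval (A v) X.poly = 0 := (hA v hv).2
  have hne : ∀ᶠ x in nhds v, x ≠ 0 := isOpen_ne.mem_nhds hv.1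
  have hev : ∀ᶠ y : ℂ × ℂ in nhds ((0 : ℂ), (0 : ℂ)), y.1 = 0 → y.2 = 0 := by
    rw [h0, h1] at hmap
    rw [← hmap, Filter.eventually_map]
    filter_upwards [hne] with x hx hx0
    exact (hA x ⟨hx, hx0⟩).2
  have hev2 : ∀ᶠ t : ℂ in nhds 0, t = 0 := by
    have hc : Filter.Tendsto (fun t : ℂ => ((0 : ℂ), t)) (nhds 0) (nhds (0, 0)) :=
      (by fun_prop : Continuous fun t : ℂ => ((0 : ℂ), t)).tendsto 0
    filter_upwards [hc.eventually hev] with t ht using ht rfl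
  have : ({0} : Set ℂ) ∈ nhds (0 : ℂ) := hev2
  exact not_isOpen_singleton (0 : ℂ) (isOpen_singleton_iff_nhds_eq_pure (0 : ℂ) |>.2
    (le_antisymm (Filter.le_pure_iff.2 this) (pure_le_nhds _)))

/-- The space `H^{2,0}(X) = H⁰(X, Ω²)` of holomorphic 2-forms on `X`. With `π` the projection of
the punctured cone to `X`, the tangent space of `X` at `π v` is `X.tangent v` modulo the line
`ℂ v`, and a 2-form `η` on `X` is the same as its pull-back `ω = π^* η` to the cone: a
family of alternating forms `ω v` on the spaces `X.tangent v` that is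
(1) horizontal: `ω v` vanishes if one argument is the radial vector `v`;
(2) invariant under the scalings `v ↦ c v`;
(3) holomorphic: locally the restriction of a holomorphic 2-form on an open subset of `ℂ⁴`. -/
def H20 : Submodule ℂ (∀ v : X.cone, X.tangent v [⋀^Fin 2]→ₗ[ℂ] ℂ) where
  carrier := {ω |
    (∀ (v : X.cone) (w : Fin 2 → X.tangent v), (w 0 : Vec4) = v → ω v w = 0) ∧
    (∀ (c : ℂ) (v v' : X.cone), (v' : Vec4) = c • (v : Vec4) →
      ∀ (w : Fin 2 → X.tangent v) (w' : Fin 2 → X.tangent v'),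
        (∀ i, (w' i : Vec4) = c • (w i : Vec4)) → ω v' w' = ω v w) ∧
    (∀ v₀ : X.cone, ∃ U : Set Vec4, IsOpen U ∧ (v₀ : Vec4) ∈ U ∧
      ∃ η : Vec4 → Vec4 [⋀^Fin 2]→ₗ[ℂ] ℂ,
        (∀ w : Fin 2 → Vec4, DifferentiableOn ℂ (fun x => η x w) U) ∧
        ∀ v : X.cone, (v : Vec4) ∈ U → ∀ w : Fin 2 → X.tangent v,
          ω v w = η v (fun i => (w i : Vec4)))}
  add_mem' := by
    rintro ω ω' ⟨h1, h2, h3⟩ ⟨h1', h2', h3'⟩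
    refine ⟨fun v w hw => by simp [h1 v w hw, h1' v w hw],
      fun c v v' hv w w' hw => by simp [h2 c v v' hv w w' hw, h2' c v v' hv w w' hw],
      fun v₀ => ?_⟩
    obtain ⟨U, hU, hv, η, hη, he⟩ := h3 v₀
    obtain ⟨U', hU', hv', η', hη', he'⟩ := h3' v₀
    refine ⟨U ∩ U', hU.inter hU', ⟨hv, hv'⟩, fun x => η x + η' x, fun w => ?_, fun v hvU w => ?_⟩
    · exact ((hη w).mono Set.inter_subset_left).add ((hη' w).mono Set.inter_subset_right)
    · simp [he v hvU.1 w, he' v hvU.2 w]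
  zero_mem' := ⟨fun _ _ _ => rfl, fun _ _ _ _ _ _ _ => rfl, fun _ =>
    ⟨Set.univ, isOpen_univ, trivial, fun _ => 0, fun _ => differentiableOn_const 0,
      fun _ _ _ => rfl⟩⟩
  smul_mem' := by
    rintro a ω ⟨h1, h2, h3⟩
    refine ⟨fun v w hw => by simp [h1 v w hw],
      fun c v v' hv w w' hw => by simp [h2 c v v' hv w w' hw], fun v₀ => ?_⟩
    obtain ⟨U, hU, hv, η, hη, he⟩ := h3 v₀
    refine ⟨U, hU, hv, fun x => a • η x, fun w => ?_, fun v hvU w => ?_⟩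
    · exact (hη w).const_smul a
    · simp [he v hvU w]

/-- The linear map `T_v → T_{A v}` induced by a linear map `A` that preserves the cone. -/
def tangentMap (A : Vec4 ≃ₗ[ℂ] Vec4) (hA : ∀ v ∈ X.cone, A v ∈ X.cone) (v : X.cone) :
    X.tangent v →ₗ[ℂ] X.tangent (A v) :=
  A.toLinearMap.restrict fun _ hw => X.map_mem_tangent A hA v.2 hw

/-- The pull-back `A^*` of holomorphic 2-forms on `X`, for an invertible linear map `A` that
preserves the cone over `X`:  `(A^* ω)_v (w₀, w₁) = ω_{A v} (A w₀, A w₁)`. -/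
def pullback (A : Vec4 ≃ₗ[ℂ] Vec4) (hA : ∀ v ∈ X.cone, A v ∈ X.cone) : X.H20 →ₗ[ℂ] X.H20 where
  toFun ω := ⟨fun v => (ω.1 ⟨A v, hA v v.2⟩).compLinearMap (X.tangentMap A hA v), by
    obtain ⟨ω, h1, h2, h3⟩ := ω
    refine ⟨fun v w hw => ?_, fun c v v' hv w w' hw => ?_, fun v₀ => ?_⟩
    · exact h1 ⟨A v, hA v v.2⟩ _ (congrArg A hw)
    · refine h2 c ⟨A v, hA v v.2⟩ ⟨A v', hA v' v'.2⟩ ?_ _ _ fun i => ?_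
      · simp [hv]
      · exact (congrArg A (hw i)).trans (map_smul A _ _)
    · obtain ⟨U, hU, hv, η, hη, he⟩ := h3 ⟨A v₀, hA v₀ v₀.2⟩
      have hAc : Differentiable ℂ (fun x : Vec4 => A x) :=
        (LinearMap.toContinuousLinearMap A.toLinearMap).differentiable
      refine ⟨A ⁻¹' U, hU.preimage hAc.continuous, hv,
        fun x => (η (A x)).compLinearMap A.toLinearMap, fun w => ?_, fun v hvU w => ?_⟩
      · exact (hη fun i => A (w i)).comp hAc.differentiableOn fun _ hx => hx
      · exact he ⟨A v, hA v v.2⟩ hvU _⟩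
  map_add' _ _ := rfl
  map_smul' _ _ := rfl

/-- `l'` and `l''` are twin lines on `X`: two disjoint lines on `X` such that there exist ten
other distinct lines on `X` each of which meets both `l'` and `l''`. -/
def AreTwinLines (l' l'' : Set P3) : Prop :=
  IsLine l' ∧ IsLine l'' ∧ l' ⊆ X.surface ∧ l'' ⊆ X.surface ∧ Disjoint l' l'' ∧
    ∃ m : Fin 10 → Set P3, Function.Injective m ∧
      ∀ i, IsLine (m i) ∧ m i ⊆ X.surface ∧ m i ≠ l' ∧ m i ≠ l'' ∧
        (m i ∩ l').Nonempty ∧ (m i ∩ l'').Nonempty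

/-- A symmetry of `X`: an automorphism of `X` that is the restriction of an automorphism of `ℙ³`.
As in the usual notation, it is recorded together with the automorphism of `ℙ³`. -/
structure Symmetry where
  /-- The automorphism of `ℙ³`. -/
  aut : Equiv.Perm P3
  aut_mem : aut ∈ AutP3
  preserves : ∀ p, aut p ∈ X.surface ↔ p ∈ X.surface

namespace Symmetry

variable {X} (τ : X.Symmetry)

/-- The symmetry as a bijection `X → X`. -/
def onSurface : Equiv.Perm X.surface := τ.aut.subtypePerm τ.preserves

/-- The fixed locus `Fix(τ, X)`, as a subset of `ℙ³`. -/
def fixX : Set P3 := Subtype.val '' {x : X.surface | τ.onSurface x = x}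

/-- The fixed locus `Fix(τ, ℙ³)`. -/
def fixP3 : Set P3 := {p | τ.aut p = p}

/-- `A` is a linear map representing the symmetry `τ`. -/
def IsLift (A : Vec4 ≃ₗ[ℂ] Vec4) : Prop := ∀ p : P3, τ.aut p = A • p

theorem IsLift.map_mem_cone {τ : X.Symmetry} {A : Vec4 ≃ₗ[ℂ] Vec4} (hA : τ.IsLift A) :
    ∀ v ∈ X.cone, A v ∈ X.cone := by
  intro v hv
  have h := (τ.preserves _).2 ((X.mk_mem_surface hv.1).2 hv)
  rw [hA] at h
  exact (X.mk_mem_surface ((map_ne_zero_iff A A.injective).2 hv.1)).1 h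

/-- The symmetry `τ` is symplectic if it acts trivially on `H^{2,0}(X)`. The pull-back of
2-forms is computed with a linear map representing `τ`, and does not depend on the choice. -/
def IsSymplectic : Prop :=
  ∀ (A : Vec4 ≃ₗ[ℂ] Vec4) (hA : τ.IsLift A), X.pullback A hA.map_mem_cone = LinearMap.id

end Symmetry

end SmoothQuartic

end

noncomputable section

/-! Choose coordinates with `l' = {x₂ = x₃ = 0}` and `l'' = {x₀ = x₁ = 0}`. Since both lines lie on
`X`, the equation splits as `F = F₃₁ + F₂₂ + F₁₃` by bidegree, with `F₃₁ = p x₂ + q x₃`, where `p`,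
`q` are binary cubics in `(x₀, x₁)`; smoothness along `l'` says that `p` and `q` have no common
zero. Both conditions turn out to be equivalent to `F₂₂ = 0`.

Twin lines give `F₂₂ = 0`: the join of `a ∈ l'` and `b ∈ l''` lies on `X` exactly when all three
parts vanish at `(a, b)`. From `F₃₁ = 0`, `b` is proportional to `(-q(a), p(a))`, so `F₂₂(a, (-q,
p))`, a form of degree 8 in `a`, has ten zeros and is identically zero; coprimality of `p` and `q`
then kills its coefficients (`form22_coeff_eq_zero`, `form22_coeff_eq_zero_of_lines`).

`F₂₂ = 0` gives twin lines: the joins on `X` correspond to zeros of `F₁₃(a, (-q, p))`, a form of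
degree 10. A multiple zero would produce a singular point of `X` (`false_of_multiple_zero`), so
there are ten distinct ones (`exists_ten_zeros`).

`F₂₂ = 0` gives the involution: `diag (1, 1, -1, -1)` has determinant 1 and sends `F` to `-F`, hence
negates the residue of `Ω / F`, a nonzero holomorphic 2-form (`not_isSymplectic`).

The involution gives `F₂₂ = 0`: a lift must be `diag (α, α, β, β)` with `α ≠ β`. On a general join,
`F` reduces to the quadratic `F₃₁ + z F₂₂ + z² F₁₃`, whose roots are stable under `z ↦ (β / α) z`;
this forces the middle coefficient to vanish (`middle_coeff_eq_zero_of_roots_stable`). -/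

/-! ### Coordinates adapted to two disjoint lines -/

theorem mk_mem_setOf_submodule_le {L : Submodule ℂ Vec4} {v : Vec4} (hv : v ≠ 0) :
    Projectivization.mk ℂ v hv ∈ {p : P3 | p.submodule ≤ L} ↔ v ∈ L := by
  simp [Projectivization.submodule_mk, Submodule.span_singleton_le_iff_mem]

/-- Splitting the coordinates of `ℂ⁴` into two pairs. -/
def splitPairs : Vec4 ≃ₗ[ℂ] (Fin 2 → ℂ) × (Fin 2 → ℂ) where
  toFun x := (![x 0, x 1], ![x 2, x 3])
  invFun y := ![y.1 0, y.1 1, y.2 0, y.2 1]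
  map_add' x y := by ext i <;> fin_cases i <;> simp
  map_smul' c x := by ext i <;> fin_cases i <;> simp
  left_inv x := by ext i; fin_cases i <;> simp
  right_inv y := by ext i <;> fin_cases i <;> simp

/-- Linear coordinates in which two given disjoint lines become `x₂ = x₃ = 0` and
`x₀ = x₁ = 0`. -/
structure AdaptedCoordinates (l' l'' : Set P3) where
  toEquiv : Vec4 ≃ₗ[ℂ] Vec4
  mem_left : ∀ x (h : toEquiv x ≠ 0),
    Projectivization.mk ℂ (toEquiv x) h ∈ l' ↔ x 2 = 0 ∧ x 3 = 0
  mem_right : ∀ x (h : toEquiv x ≠ 0),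
    Projectivization.mk ℂ (toEquiv x) h ∈ l'' ↔ x 0 = 0 ∧ x 1 = 0

/-- Disjoint lines come from planes of `ℂ⁴` meeting only in 0, which are complementary because 2 + 2
= 4; bases of the two planes together give the coordinates. -/
theorem exists_adaptedCoordinates {l' l'' : Set P3} (hl' : IsLine l') (hl'' : IsLine l'')
    (hdisj : Disjoint l' l'') : Nonempty (AdaptedCoordinates l' l'') := by
  obtain ⟨L', h', rfl⟩ := hl'
  obtain ⟨L'', h'', rfl⟩ := hl''
  have hd : Disjoint L' L'' := by
    rw [Submodule.disjoint_def]
    intro v hv' hv''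
    by_contra hv
    exact Set.disjoint_left.1 hdisj ((mk_mem_setOf_submodule_le hv).2 hv')
      ((mk_mem_setOf_submodule_le hv).2 hv'')
  have hc : IsCompl L' L'' := by
    refine (Submodule.isCompl_iff_disjoint _ _ ?_).2 hd
    simp [h', h'']
  let e' : L' ≃ₗ[ℂ] (Fin 2 → ℂ) := LinearEquiv.ofFinrankEq _ _ (by simp [h'])
  let e'' : L'' ≃ₗ[ℂ] (Fin 2 → ℂ) := LinearEquiv.ofFinrankEq _ _ (by simp [h''])
  let B : Vec4 ≃ₗ[ℂ] Vec4 := (splitPairs.trans (e'.symm.prodCongr e''.symm)).trans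
    (Submodule.prodEquivOfIsCompl L' L'' hc)
  have hB : ∀ x, B x = (e'.symm ![x 0, x 1] : Vec4) + (e''.symm ![x 2, x 3] : Vec4) := by
    intro x; simp [B, splitPairs]
  have hpair : ∀ a b : ℂ, ![a, b] = 0 ↔ a = 0 ∧ b = 0 := by
    intro a b
    simp
  refine ⟨⟨B, fun x h => ?_, fun x h => ?_⟩⟩
  · rw [mk_mem_setOf_submodule_le, hB, Submodule.add_mem_iff_right _ (Subtype.mem _), ← hpair]
    constructor
    · intro hx
      have := Submodule.disjoint_def.1 hd _ hx (Subtype.mem _)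
      simpa using this
    · intro hx; rw [hx]; simp
  · rw [mk_mem_setOf_submodule_le, hB, Submodule.add_mem_iff_left _ (Subtype.mem _), ← hpair]
    constructor
    · intro hx
      have := Submodule.disjoint_def.1 hd _ (Subtype.mem _) hx
      simpa using this
    · intro hx; rw [hx]; simp

/-! ### Bihomogeneous decomposition of the quartic -/

/-- The binary cubic form with given coefficients. -/
def cubicForm {R : Type*} [CommSemiring R] (c : Fin 4 → R) (x y : R) : R :=
  c 0 * x ^ 3 + c 1 * x ^ 2 * y + c 2 * x * y ^ 2 + c 3 * y ^ 3

/-- The binary quadratic form with given coefficients. -/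
def quadForm {R : Type*} [CommSemiring R] (c : Fin 3 → R) (x y : R) : R :=
  c 0 * x ^ 2 + c 1 * x * y + c 2 * y ^ 2

/-- The form `p(x₀, x₁) x₂ + q(x₀, x₁) x₃` of bidegree `(3, 1)`. -/
def form31 (p q : Fin 4 → ℂ) : MvPolynomial (Fin 4) ℂ :=
  cubicForm (fun i => C (p i)) (X 0) (X 1) * X 2 + cubicForm (fun i => C (q i)) (X 0) (X 1) * X 3

/-- The form `u(x₀, x₁) x₂² + v(x₀, x₁) x₂ x₃ + w(x₀, x₁) x₃²` of bidegree `(2, 2)`. -/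
def form22 (u v w : Fin 3 → ℂ) : MvPolynomial (Fin 4) ℂ :=
  quadForm (fun i => C (u i)) (X 0) (X 1) * X 2 ^ 2 +
    quadForm (fun i => C (v i)) (X 0) (X 1) * (X 2 * X 3) +
    quadForm (fun i => C (w i)) (X 0) (X 1) * X 3 ^ 2

/-- The form `r(x₂, x₃) x₀ + s(x₂, x₃) x₁` of bidegree `(1, 3)`. -/
def form13 (r s : Fin 4 → ℂ) : MvPolynomial (Fin 4) ℂ :=
  cubicForm (fun i => C (r i)) (X 2) (X 3) * X 0 + cubicForm (fun i => C (s i)) (X 2) (X 3) * X 1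

theorem eval_form31 (p q : Fin 4 → ℂ) (x : Vec4) : eval x (form31 p q) =
    cubicForm p (x 0) (x 1) * x 2 + cubicForm q (x 0) (x 1) * x 3 := by
  simp [form31, cubicForm]

theorem eval_form22 (u v w : Fin 3 → ℂ) (x : Vec4) : eval x (form22 u v w) =
    quadForm u (x 0) (x 1) * x 2 ^ 2 + quadForm v (x 0) (x 1) * (x 2 * x 3) +
      quadForm w (x 0) (x 1) * x 3 ^ 2 := by
  simp [form22, quadForm]

theorem eval_form13 (r s : Fin 4 → ℂ) (x : Vec4) : eval x (form13 r s) =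
    cubicForm r (x 2) (x 3) * x 0 + cubicForm s (x 2) (x 3) * x 1 := by
  simp [form13, cubicForm]

/-- A quartic form is a sum of bihomogeneous parts. -/
theorem exists_quartic_expansion {Φ : MvPolynomial (Fin 4) ℂ} (hΦ : Φ.IsHomogeneous 4) :
    ∃ (c d : Fin 5 → ℂ) (p q : Fin 4 → ℂ) (u v w : Fin 3 → ℂ) (r s : Fin 4 → ℂ), ∀ x : Vec4,
      eval x Φ = (c 0 * x 0 ^ 4 + c 1 * x 0 ^ 3 * x 1 + c 2 * x 0 ^ 2 * x 1 ^ 2 +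
          c 3 * x 0 * x 1 ^ 3 + c 4 * x 1 ^ 4) +
        (d 0 * x 2 ^ 4 + d 1 * x 2 ^ 3 * x 3 + d 2 * x 2 ^ 2 * x 3 ^ 2 +
          d 3 * x 2 * x 3 ^ 3 + d 4 * x 3 ^ 4) +
        (eval x (form31 p q) + eval x (form22 u v w) + eval x (form13 r s)) := by
  let k : (Fin 4 → ℕ) → ℂ := fun d => coeff (Finsupp.equivFunOnFinite.symm d) Φ
  have key : ∀ x, eval x Φ = ∑ d ∈ Finset.Nat.antidiagonalTuple 4 4, k d * ∏ i, x i ^ d i := by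
    intro x
    rw [eval_eq']
    refine Finset.sum_bij_ne_zero (fun d _ _ => ⇑d) (fun d hd _ => ?_)
      (fun _ _ _ _ _ _ h => DFunLike.coe_injective h) (fun d _ hd => ?_) (fun d _ _ => ?_)
    · refine Finset.Nat.mem_antidiagonalTuple.2 (Eq.trans ?_ (hΦ (mem_support_iff.1 hd)))
      rw [Finsupp.weight_apply, Finsupp.sum_fintype] <;> simp
    · refine ⟨Finsupp.equivFunOnFinite.symm d, ?_, ?_, rfl⟩
      · rw [mem_support_iff]; exact left_ne_zero_of_mul hd
      · exact hd
    · simp [k]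
  refine ⟨![k ![4,0,0,0], k ![3,1,0,0], k ![2,2,0,0], k ![1,3,0,0], k ![0,4,0,0]],
    ![k ![0,0,4,0], k ![0,0,3,1], k ![0,0,2,2], k ![0,0,1,3], k ![0,0,0,4]],
    ![k ![3,0,1,0], k ![2,1,1,0], k ![1,2,1,0], k ![0,3,1,0]],
    ![k ![3,0,0,1], k ![2,1,0,1], k ![1,2,0,1], k ![0,3,0,1]],
    ![k ![2,0,2,0], k ![1,1,2,0], k ![0,2,2,0]],
    ![k ![2,0,1,1], k ![1,1,1,1], k ![0,2,1,1]],
    ![k ![2,0,0,2], k ![1,1,0,2], k ![0,2,0,2]],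
    ![k ![1,0,3,0], k ![1,0,2,1], k ![1,0,1,2], k ![1,0,0,3]],
    ![k ![0,1,3,0], k ![0,1,2,1], k ![0,1,1,2], k ![0,1,0,3]], fun x => ?_⟩
  rw [key, eval_form31, eval_form22, eval_form13]
  have hl : List.Nat.antidiagonalTuple 4 4 = [
      ![0,0,0,4], ![0,0,1,3], ![0,0,2,2], ![0,0,3,1], ![0,0,4,0], ![0,1,0,3], ![0,1,1,2],
      ![0,1,2,1], ![0,1,3,0], ![0,2,0,2], ![0,2,1,1], ![0,2,2,0], ![0,3,0,1], ![0,3,1,0],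
      ![0,4,0,0], ![1,0,0,3], ![1,0,1,2], ![1,0,2,1], ![1,0,3,0], ![1,1,0,2], ![1,1,1,1],
      ![1,1,2,0], ![1,2,0,1], ![1,2,1,0], ![1,3,0,0], ![2,0,0,2], ![2,0,1,1], ![2,0,2,0],
      ![2,1,0,1], ![2,1,1,0], ![2,2,0,0], ![3,0,0,1], ![3,0,1,0], ![3,1,0,0], ![4,0,0,0]] := by decide
  have hsum : ∀ f : (Fin 4 → ℕ) → ℂ, ∑ d ∈ Finset.Nat.antidiagonalTuple 4 4, f d =
      ((List.Nat.antidiagonalTuple 4 4).map f).sum := fun f => rfl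
  rw [hsum, hl]
  simp only [List.map_cons, List.map_nil, List.sum_cons, List.sum_nil, Fin.prod_univ_four]
  simp only [cubicForm, quadForm, Matrix.cons_val, pow_zero, mul_one, pow_one, add_zero]
  ring

/-- The chain rule for a linear change of coordinates. -/
theorem polyDiff_of_eval_comp {F Φ : MvPolynomial (Fin 4) ℂ} (A : Vec4 →ₗ[ℂ] Vec4) (k : ℂ)
    (h : ∀ x, eval (A x) F = k * eval x Φ) (x y : Vec4) :
    polyDiff F (A x) (A y) = k * polyDiff Φ x y := by
  set A' : Vec4 →L[ℂ] Vec4 := LinearMap.toContinuousLinearMap A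
  have h1 : HasStrictFDerivAt (fun x : Vec4 => eval (A x) F)
      ((LinearMap.toContinuousLinearMap (polyDiff F (A x))).comp A') x :=
    (hasStrictFDerivAt_eval F (A' x)).comp x A'.hasStrictFDerivAt
  simp only [h] at h1
  have h2 := (hasStrictFDerivAt_eval Φ x).const_mul k
  have h3 := h1.hasFDerivAt.unique h2.hasFDerivAt
  exact congrArg (fun T : Vec4 →L[ℂ] ℂ => T y) h3

theorem polyDiff_apply (F : MvPolynomial (Fin 4) ℂ) (v w : Vec4) :
    polyDiff F v w = ∑ i, eval v (pderiv i F) * w i := by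
  simp [polyDiff]

/-- By the chain rule the differentials of the two equations correspond under the invertible map
`B`, so singular points can be sought in adapted coordinates. -/
theorem SmoothQuartic.smooth_coordinates (X : SmoothQuartic) (B : Vec4 ≃ₗ[ℂ] Vec4)
    {Φ : MvPolynomial (Fin 4) ℂ} (h : ∀ x, eval (B x) X.poly = eval x Φ) {x : Vec4} (hx : x ≠ 0)
    (h0 : eval x Φ = 0) : ∃ i, eval x (pderiv i Φ) ≠ 0 := by
  by_contra! hc
  obtain ⟨i, hi⟩ := X.smooth (B x) ((map_ne_zero_iff B B.injective).2 hx) (by rw [h, h0])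
  have h1 := polyDiff_of_eval_comp (Φ := Φ) B.toLinearMap 1 (by simpa using h) x
    (B.symm (Pi.single i 1))
  simp [polyDiff_apply, hc, Pi.single_apply] at h1
  exact hi h1

/-- The pure quartic parts in `(x₀, x₁)` and in `(x₂, x₃)` are the restrictions of the equation to
`l'` and `l''`, hence vanish. -/
theorem exists_bihomogeneous_form (X : SmoothQuartic) {l' l'' : Set P3}
    (B : AdaptedCoordinates l' l'') (hX' : l' ⊆ X.surface) (hX'' : l'' ⊆ X.surface) :
    ∃ (p q : Fin 4 → ℂ) (u v w : Fin 3 → ℂ) (r s : Fin 4 → ℂ), ∀ x : Vec4,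
      eval (B.toEquiv x) X.poly = eval x (form31 p q + form22 u v w + form13 r s) := by
  let M := LinearMap.toMatrix' B.toEquiv.toLinearMap
  let Φ : MvPolynomial (Fin 4) ℂ :=
    aeval (fun i => ∑ j, C (M i j) * MvPolynomial.X j) X.poly
  have hΦ : Φ.IsHomogeneous 4 := by
    have h := X.homogeneous.aeval (n := 1) (fun i => ∑ j, C (M i j) * MvPolynomial.X j)
      fun i => IsHomogeneous.sum _ _ _ fun j _ => by
        simpa using (isHomogeneous_C (Fin 4) (M i j)).mul (isHomogeneous_X ℂ j)
    simpa only [one_mul] using h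
  have hBx : ∀ x i, B.toEquiv x i = ∑ j, M i j * x j := by
    intro x i
    exact (congrFun (LinearMap.toMatrix'_mulVec B.toEquiv.toLinearMap x) i).symm
  have hev : ∀ x, eval (B.toEquiv x) X.poly = eval x Φ := by
    intro x
    have h : (aeval (R := ℂ) (B.toEquiv x) : MvPolynomial (Fin 4) ℂ →ₐ[ℂ] ℂ) =
        (aeval (R := ℂ) x).comp (aeval (fun i => ∑ j, C (M i j) * MvPolynomial.X j)) := by
      ext i
      simp [hBx]
    simpa [Φ, coe_aeval_eq_eval] using congrArg (fun f => f X.poly) h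
  obtain ⟨c, d, p, q, u, v, w, r, s, h⟩ := exists_quartic_expansion hΦ
  refine ⟨p, q, u, v, w, r, s, fun x => ?_⟩
  have hzero : ∀ x, (x 2 = 0 ∧ x 3 = 0) ∨ (x 0 = 0 ∧ x 1 = 0) → eval x Φ = 0 := by
    intro x hx
    by_cases h0 : x = 0
    · rw [h, eval_form31, eval_form22, eval_form13, h0]; simp [cubicForm]
    · have hB : B.toEquiv x ≠ 0 := (map_ne_zero_iff _ B.toEquiv.injective).2 h0
      rw [← hev]
      exact ((X.mk_mem_surface hB).1 (hx.elim (fun hx => hX' ((B.mem_left x hB).2 hx))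
        fun hx => hX'' ((B.mem_right x hB).2 hx))).2
  have hc : ∀ a b : ℂ, c 0 * a ^ 4 + c 1 * a ^ 3 * b + c 2 * a ^ 2 * b ^ 2 + c 3 * a * b ^ 3 +
      c 4 * b ^ 4 = 0 := by
    intro a b
    have := hzero ![a, b, 0, 0] (by simp)
    rw [h, eval_form31, eval_form22, eval_form13] at this
    simpa [cubicForm, quadForm] using this
  have hd : ∀ a b : ℂ, d 0 * a ^ 4 + d 1 * a ^ 3 * b + d 2 * a ^ 2 * b ^ 2 + d 3 * a * b ^ 3 +
      d 4 * b ^ 4 = 0 := by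
    intro a b
    have := hzero ![0, 0, a, b] (by simp)
    rw [h, eval_form31, eval_form22, eval_form13] at this
    simpa [cubicForm, quadForm] using this
  rw [hev, h, hc, hd]
  simp

theorem eval_pderiv_form31 (p q : Fin 4 → ℂ) (x : Vec4) :
    eval x (pderiv 0 (form31 p q)) =
      (3 * p 0 * x 0 ^ 2 + 2 * p 1 * x 0 * x 1 + p 2 * x 1 ^ 2) * x 2 +
      (3 * q 0 * x 0 ^ 2 + 2 * q 1 * x 0 * x 1 + q 2 * x 1 ^ 2) * x 3 ∧
    eval x (pderiv 1 (form31 p q)) =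
      (p 1 * x 0 ^ 2 + 2 * p 2 * x 0 * x 1 + 3 * p 3 * x 1 ^ 2) * x 2 +
      (q 1 * x 0 ^ 2 + 2 * q 2 * x 0 * x 1 + 3 * q 3 * x 1 ^ 2) * x 3 ∧
    eval x (pderiv 2 (form31 p q)) = cubicForm p (x 0) (x 1) ∧
    eval x (pderiv 3 (form31 p q)) = cubicForm q (x 0) (x 1) := by
  refine ⟨?_, ?_, ?_, ?_⟩ <;>
  · simp [form31, cubicForm, pderiv_X, Derivation.leibniz_pow]
    try ring

theorem eval_pderiv_form13 (r s : Fin 4 → ℂ) (x : Vec4) :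
    eval x (pderiv 0 (form13 r s)) = cubicForm r (x 2) (x 3) ∧
    eval x (pderiv 1 (form13 r s)) = cubicForm s (x 2) (x 3) ∧
    eval x (pderiv 2 (form13 r s)) =
      (3 * r 0 * x 2 ^ 2 + 2 * r 1 * x 2 * x 3 + r 2 * x 3 ^ 2) * x 0 +
      (3 * s 0 * x 2 ^ 2 + 2 * s 1 * x 2 * x 3 + s 2 * x 3 ^ 2) * x 1 ∧
    eval x (pderiv 3 (form13 r s)) =
      (r 1 * x 2 ^ 2 + 2 * r 2 * x 2 * x 3 + 3 * r 3 * x 3 ^ 2) * x 0 +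
      (s 1 * x 2 ^ 2 + 2 * s 2 * x 2 * x 3 + 3 * s 3 * x 3 ^ 2) * x 1 := by
  refine ⟨?_, ?_, ?_, ?_⟩ <;>
  · simp [form13, cubicForm, pderiv_X, Derivation.leibniz_pow]
    try ring

/-- A form of bidegree `(2, 2)` vanishes to order two along both lines, so it has no influence on
smoothness there. -/
theorem eval_pderiv_form22_eq_zero (u v w : Fin 3 → ℂ) {x : Vec4}
    (h : (x 2 = 0 ∧ x 3 = 0) ∨ (x 0 = 0 ∧ x 1 = 0)) (i : Fin 4) :
    eval x (pderiv i (form22 u v w)) = 0 := by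
  rcases h with ⟨h, h'⟩ | ⟨h, h'⟩ <;> fin_cases i <;>
    simp [form22, quadForm, pderiv_X, Derivation.leibniz_pow, h, h']

/-! ### Smoothness along the two lines -/

section Smooth

variable {p q : Fin 4 → ℂ} {u v w : Fin 3 → ℂ} {r s : Fin 4 → ℂ}

/-- Smoothness along `x₂ = x₃ = 0`. -/
theorem cubicForm_ne_zero_of_smooth31
    (hs : ∀ x : Vec4, x ≠ 0 → eval x (form31 p q + form22 u v w + form13 r s) = 0 →
      ∃ i, eval x (pderiv i (form31 p q + form22 u v w + form13 r s)) ≠ 0)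
    {a b : ℂ} (hp : cubicForm p a b = 0) (hq : cubicForm q a b = 0) : a = 0 ∧ b = 0 := by
  by_contra hab
  obtain ⟨i, hi⟩ := hs ![a, b, 0, 0] (fun h => hab ⟨congrFun h 0, congrFun h 1⟩)
    (by simp [eval_form31, eval_form22, eval_form13, cubicForm, quadForm])
  apply hi
  obtain ⟨h0, h1, h2, h3⟩ := eval_pderiv_form31 p q ![a, b, 0, 0]
  obtain ⟨k0, k1, k2, k3⟩ := eval_pderiv_form13 r s ![a, b, 0, 0]
  have hm := eval_pderiv_form22_eq_zero u v w (x := ![a, b, 0, 0]) (by simp) i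
  rw [map_add, map_add, map_add, map_add, hm]
  fin_cases i
  · simp [h0, k0, cubicForm]
  · simp [h1, k1, cubicForm]
  · simp [h2, k2, hp]
  · simp [h3, k3, hq]

/-- Smoothness along `x₀ = x₁ = 0`. -/
theorem cubicForm_ne_zero_of_smooth13
    (hs : ∀ x : Vec4, x ≠ 0 → eval x (form31 p q + form22 u v w + form13 r s) = 0 →
      ∃ i, eval x (pderiv i (form31 p q + form22 u v w + form13 r s)) ≠ 0)
    {a b : ℂ} (hp : cubicForm r a b = 0) (hq : cubicForm s a b = 0) : a = 0 ∧ b = 0 := by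
  by_contra hab
  obtain ⟨i, hi⟩ := hs ![0, 0, a, b] (fun h => hab ⟨congrFun h 2, congrFun h 3⟩)
    (by simp [eval_form31, eval_form22, eval_form13, cubicForm, quadForm])
  apply hi
  obtain ⟨h0, h1, h2, h3⟩ := eval_pderiv_form31 p q ![0, 0, a, b]
  obtain ⟨k0, k1, k2, k3⟩ := eval_pderiv_form13 r s ![0, 0, a, b]
  have hm := eval_pderiv_form22_eq_zero u v w (x := ![0, 0, a, b]) (by simp) i
  rw [map_add, map_add, map_add, map_add, hm]
  fin_cases i
  · simp [h0, k0, hp]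
  · simp [h1, k1, hq]
  · simp [h2, k2, cubicForm]
  · simp [h3, k3, cubicForm]

end Smooth

/-! ### A `(2, 2)`-form on the curve `b = (-q(a), p(a))` -/

section Univariate

open Polynomial

/-- The dehomogenization of a binary cubic form. -/
def cubicPoly (c : Fin 4 → ℂ) : ℂ[X] :=
  cubicForm (fun i => Polynomial.C (c i)) Polynomial.X 1

/-- The dehomogenization of a binary quadratic form. -/
def quadPoly (c : Fin 3 → ℂ) : ℂ[X] :=
  quadForm (fun i => Polynomial.C (c i)) Polynomial.X 1

theorem eval_cubicPoly (c : Fin 4 → ℂ) (t : ℂ) : (cubicPoly c).eval t = cubicForm c t 1 := by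
  simp [cubicPoly, cubicForm]

theorem eval_quadPoly (c : Fin 3 → ℂ) (t : ℂ) : (quadPoly c).eval t = quadForm c t 1 := by
  simp [quadPoly, quadForm]

theorem natDegree_cubicPoly_le (c : Fin 4 → ℂ) : (cubicPoly c).natDegree ≤ 3 := by
  simp only [cubicPoly, cubicForm, one_pow, mul_one]
  compute_degree

theorem natDegree_quadPoly_le (c : Fin 3 → ℂ) : (quadPoly c).natDegree ≤ 2 := by
  simp only [quadPoly, quadForm, one_pow, mul_one]
  compute_degree

theorem coeff_cubicPoly_three (c : Fin 4 → ℂ) : (cubicPoly c).coeff 3 = c 0 := by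
  simp [cubicPoly, cubicForm, Polynomial.coeff_X_pow]

theorem eq_zero_of_quadPoly_eq_zero {c : Fin 3 → ℂ} (h : quadPoly c = 0) : c = 0 := by
  have h' := fun n => congrArg (fun f => Polynomial.coeff f n) h
  have h0 := h' 0
  have h1 := h' 1
  have h2 := h' 2
  simp [quadPoly, quadForm, Polynomial.coeff_X, Polynomial.coeff_C, Polynomial.coeff_X_pow]
    at h0 h1 h2
  ext i
  fin_cases i <;> simp_all

theorem quadPoly_eq_zero_of_dvd {f : ℂ[X]} (hf : 2 < f.natDegree) {c : Fin 3 → ℂ}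
    (h : f ∣ quadPoly c) : quadPoly c = 0 :=
  Polynomial.eq_zero_of_dvd_of_natDegree_lt h ((natDegree_quadPoly_le c).trans_lt hf)

/-- Modulo `p` only the first term survives, so `p` divides `quadPoly u` by coprimality, and the
degrees force it to be zero. Cancelling a factor `p` allows the same argument for `v`, and then `w`
is left alone. -/
theorem quadPoly_eq_zero_of_relation {p q : ℂ[X]} (hc : IsCoprime p q) (hp : 2 < p.natDegree)
    {u v w : Fin 3 → ℂ}
    (h : quadPoly u * q ^ 2 - quadPoly v * (q * p) + quadPoly w * p ^ 2 = 0) :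
    quadPoly u = 0 ∧ quadPoly v = 0 ∧ quadPoly w = 0 := by
  have hp0 : p ≠ 0 := by rintro rfl; simp at hp
  have hu : quadPoly u = 0 := by
    refine quadPoly_eq_zero_of_dvd hp ((hc.pow_right (n := 2)).dvd_of_dvd_mul_right ?_)
    exact ⟨quadPoly v * q - quadPoly w * p, by linear_combination h⟩
  have h2 : p * (quadPoly w * p - quadPoly v * q) = 0 := by
    rw [hu] at h; linear_combination h
  have h3 := (mul_eq_zero.1 h2).resolve_left hp0
  have hv : quadPoly v = 0 := by
    refine quadPoly_eq_zero_of_dvd hp (hc.dvd_of_dvd_mul_right ?_)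
    exact ⟨quadPoly w, by linear_combination -h3⟩
  refine ⟨hu, hv, ?_⟩
  rw [hv, zero_mul, sub_zero] at h3
  exact (mul_eq_zero.1 h3).resolve_right hp0

/-- If a `(2, 2)`-form vanishes at `9` points of a curve of bidegree `(3, 1)` that is a graph,
then it is zero. -/
theorem form22_coeff_eq_zero {p q : Fin 4 → ℂ} {u v w : Fin 3 → ℂ}
    (hpq : ∀ a b : ℂ, cubicForm p a b = 0 → cubicForm q a b = 0 → a = 0 ∧ b = 0)
    (S : Finset ℂ) (hS : 9 ≤ S.card)
    (h : ∀ t ∈ S, quadForm u t 1 * cubicForm q t 1 ^ 2 -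
      quadForm v t 1 * (cubicForm q t 1 * cubicForm p t 1) +
      quadForm w t 1 * cubicForm p t 1 ^ 2 = 0) :
    u = 0 ∧ v = 0 ∧ w = 0 := by
  have hrel : quadPoly u * cubicPoly q ^ 2 - quadPoly v * (cubicPoly q * cubicPoly p) +
      quadPoly w * cubicPoly p ^ 2 = 0 := by
    refine Polynomial.eq_zero_of_natDegree_lt_card_of_eval_eq_zero' _ S (fun t ht => ?_)
      -- The degree bound is `8 = 2 + 2 * 3`, so nine zeros suffice.
      (lt_of_le_of_lt (b := 8) ?_ hS)
    · simpa [eval_cubicPoly, eval_quadPoly] using h t ht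
    · have hu := natDegree_quadPoly_le u
      have hv := natDegree_quadPoly_le v
      have hw := natDegree_quadPoly_le w
      have hp := natDegree_cubicPoly_le p
      have hq := natDegree_cubicPoly_le q
      refine Polynomial.natDegree_add_le_of_degree_le
        ((Polynomial.natDegree_sub_le_of_le (m := 8) (n := 8) ?_ ?_).trans (max_self 8).le) ?_
      · exact Polynomial.natDegree_mul_le_of_le hu (Polynomial.natDegree_pow_le_of_le 2 hq)
      · exact Polynomial.natDegree_mul_le_of_le hv (Polynomial.natDegree_mul_le_of_le hq hp)
      · exact Polynomial.natDegree_mul_le_of_le hw (Polynomial.natDegree_pow_le_of_le 2 hp)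
  have hcop : IsCoprime (cubicPoly p) (cubicPoly q) := by
    rw [Polynomial.isCoprime_iff_aeval_ne_zero_of_isAlgClosed ℂ ℂ]
    intro t
    by_contra! ht
    simp only [Polynomial.coe_aeval_eq_eval, eval_cubicPoly] at ht
    exact one_ne_zero (hpq t 1 ht.1 ht.2).2
  have key : quadPoly u = 0 ∧ quadPoly v = 0 ∧ quadPoly w = 0 := by
    -- `p 0` is the value of the cubic at the point at infinity. If it vanishes, `cubicPoly p` drops
    -- degree, but then `cubicPoly q` has degree 3 and the roles of `p, u` and `q, w` are exchanged.
    by_cases hp0 : p 0 = 0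
    · have hq0 : q 0 ≠ 0 := fun hq0 =>
        one_ne_zero (hpq 1 0 (by simp [cubicForm, hp0]) (by simp [cubicForm, hq0])).1
      have hd : 2 < (cubicPoly q).natDegree :=
        Polynomial.le_natDegree_of_ne_zero (n := 3) (by rwa [coeff_cubicPoly_three])
      obtain ⟨hw, hv, hu⟩ := quadPoly_eq_zero_of_relation hcop.symm hd
        (u := w) (v := v) (w := u) (by linear_combination hrel)
      exact ⟨hu, hv, hw⟩
    · have hd : 2 < (cubicPoly p).natDegree :=
        Polynomial.le_natDegree_of_ne_zero (n := 3) (by rwa [coeff_cubicPoly_three])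
      exact quadPoly_eq_zero_of_relation hcop hd hrel
  exact ⟨eq_zero_of_quadPoly_eq_zero key.1, eq_zero_of_quadPoly_eq_zero key.2.1,
    eq_zero_of_quadPoly_eq_zero key.2.2⟩

end Univariate

/-! ### The eliminant of degree ten and its simple zeros -/

/-- The partial derivative of a binary cubic form in the first variable. -/
def cubicDx {R : Type*} [CommSemiring R] (c : Fin 4 → R) (x y : R) : R :=
  3 * c 0 * x ^ 2 + 2 * c 1 * x * y + c 2 * y ^ 2

/-- The partial derivative of a binary cubic form in the second variable. -/
def cubicDy {R : Type*} [CommSemiring R] (c : Fin 4 → R) (x y : R) : R :=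
  c 1 * x ^ 2 + 2 * c 2 * x * y + 3 * c 3 * y ^ 2

/-- A point `(x, y)` at which the form `r(-q, p) x + s(-q, p) y` of degree `10` and both its
partial derivatives vanish gives a singular point of the quartic. -/
theorem false_of_multiple_zero {p q r s : Fin 4 → ℂ}
    (hpq : ∀ a b : ℂ, cubicForm p a b = 0 → cubicForm q a b = 0 → a = 0 ∧ b = 0)
    (hs : ∀ x : Vec4, x ≠ 0 → eval x (form31 p q + form13 r s) = 0 →
      ∃ i, eval x (pderiv i (form31 p q + form13 r s)) ≠ 0)
    {x y P Q D E : ℂ} (hxy : ¬ (x = 0 ∧ y = 0)) (hP : cubicForm p x y = P)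
    (hQ : cubicForm q x y = Q)
    (hD : cubicDx r (-Q) P * x + cubicDx s (-Q) P * y = D)
    (hE : cubicDy r (-Q) P * x + cubicDy s (-Q) P * y = E)
    (h : cubicForm r (-Q) P * x + cubicForm s (-Q) P * y = 0)
    (hx : cubicForm r (-Q) P - D * cubicDx q x y + E * cubicDx p x y = 0)
    (hy : cubicForm s (-Q) P - D * cubicDy q x y + E * cubicDy p x y = 0) : False := by
  have hPQ : ¬ (P = 0 ∧ Q = 0) := fun hc => hxy (hpq x y (hP.trans hc.1) (hQ.trans hc.2))
  -- `D` and `E` are the partials of the `(1, 3)` part in `x₂`, `x₃` at `(x, y, -Q, P)`; this is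
  -- Euler's identity for a form of degree 3 in these variables. It makes `(D, E)` proportional to
  -- `(P, Q)`.
  have hEuler : -Q * D + P * E = 0 := by
    rw [← hD, ← hE]
    simp only [cubicForm, cubicDx, cubicDy] at h ⊢
    linear_combination 3 * h
  obtain ⟨k, hkD, hkE⟩ : ∃ k, D = k * P ∧ E = k * Q := by
    by_cases hP0 : P = 0
    · have hQ0 : Q ≠ 0 := fun hQ0 => hPQ ⟨hP0, hQ0⟩
      refine ⟨E / Q, ?_, by field_simp⟩
      rw [hP0, zero_mul, add_zero, neg_mul, neg_eq_zero] at hEuler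
      rw [hP0, mul_zero]
      exact (mul_eq_zero.1 hEuler).resolve_left hQ0
    · refine ⟨D / P, by field_simp, ?_⟩
      field_simp
      linear_combination hEuler
  -- Rescaling `(x, y)` by `σ` multiplies the `x₂`, `x₃` partials of the `(3, 1)` part by `σ³` and
  -- those of the `(1, 3)` part by `σ`; they are `σ³ (P, Q)` and `σ k (P, Q)`, which cancel for `σ²
  -- = -k`. With this choice the other two partials become `hx` and `hy`.
  obtain ⟨σ, hσ⟩ := IsSquare.exists_sq (-k) (IsAlgClosed.exists_eq_mul_self (-k))
  obtain ⟨i, hi⟩ := hs ![σ * x, σ * y, -Q, P]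
    (fun hz => hPQ ⟨by simpa using congrFun hz 3, by simpa using congrFun hz 2⟩) (by
      rw [map_add, eval_form31, eval_form13]
      simp only [cubicForm, Matrix.cons_val] at h hP hQ ⊢
      linear_combination σ * h - σ ^ 3 * Q * hP + σ ^ 3 * P * hQ)
  apply hi
  obtain ⟨h0, h1, h2, h3⟩ := eval_pderiv_form31 p q ![σ * x, σ * y, -Q, P]
  obtain ⟨k0, k1, k2, k3⟩ := eval_pderiv_form13 r s ![σ * x, σ * y, -Q, P]
  rw [map_add, map_add]
  simp only [cubicForm, cubicDx, cubicDy, Matrix.cons_val] at *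
  fin_cases i
  · simp only [Fin.zero_eta, h0, k0]
    linear_combination hx + (3 * q 0 * x ^ 2 + 2 * q 1 * x * y + q 2 * y ^ 2) * hkD -
      (3 * p 0 * x ^ 2 + 2 * p 1 * x * y + p 2 * y ^ 2) * hkE -
      (P * (3 * q 0 * x ^ 2 + 2 * q 1 * x * y + q 2 * y ^ 2) -
        Q * (3 * p 0 * x ^ 2 + 2 * p 1 * x * y + p 2 * y ^ 2)) * hσ
  · simp only [Fin.mk_one, h1, k1]
    linear_combination hy + (q 1 * x ^ 2 + 2 * q 2 * x * y + 3 * q 3 * y ^ 2) * hkD -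
      (p 1 * x ^ 2 + 2 * p 2 * x * y + 3 * p 3 * y ^ 2) * hkE -
      (P * (q 1 * x ^ 2 + 2 * q 2 * x * y + 3 * q 3 * y ^ 2) -
        Q * (p 1 * x ^ 2 + 2 * p 2 * x * y + 3 * p 3 * y ^ 2)) * hσ
  · simp only [Fin.reduceFinMk, h2, k2]
    linear_combination σ ^ 3 * hP + σ * hD + σ * hkD - σ * P * hσ
  · simp only [Fin.reduceFinMk, h3, k3]
    linear_combination σ ^ 3 * hQ + σ * hE + σ * hkE - σ * Q * hσ

section Univariate

open Polynomial

theorem derivative_cubicForm (c : Fin 4 → ℂ) (f g : ℂ[X]) :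
    Polynomial.derivative (cubicForm (fun i => Polynomial.C (c i)) f g) =
      cubicDx (fun i => Polynomial.C (c i)) f g * Polynomial.derivative f +
        cubicDy (fun i => Polynomial.C (c i)) f g * Polynomial.derivative g := by
  simp [cubicForm, cubicDx, cubicDy, Polynomial.derivative_pow, map_ofNat]
  ring

theorem eval_cubicForm (c : Fin 4 → ℂ) (f g : ℂ[X]) (t : ℂ) :
    (cubicForm (fun i => Polynomial.C (c i)) f g).eval t = cubicForm c (f.eval t) (g.eval t) := by
  simp [cubicForm]

theorem eval_cubicDx (c : Fin 4 → ℂ) (f g : ℂ[X]) (t : ℂ) :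
    (cubicDx (fun i => Polynomial.C (c i)) f g).eval t = cubicDx c (f.eval t) (g.eval t) := by
  simp [cubicDx]

theorem eval_cubicDy (c : Fin 4 → ℂ) (f g : ℂ[X]) (t : ℂ) :
    (cubicDy (fun i => Polynomial.C (c i)) f g).eval t = cubicDy c (f.eval t) (g.eval t) := by
  simp [cubicDy]

/-- `f` has degree at most `n`, and `a` is its coefficient at `X ^ n`. -/
def HasTopCoeff (f : ℂ[X]) (n : ℕ) (a : ℂ) : Prop := f.natDegree ≤ n ∧ f.coeff n = a

theorem HasTopCoeff.mul {f g : ℂ[X]} {m n : ℕ} {a b : ℂ} (hf : HasTopCoeff f m a)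
    (hg : HasTopCoeff g n b) : HasTopCoeff (f * g) (m + n) (a * b) :=
  ⟨Polynomial.natDegree_mul_le_of_le hf.1 hg.1, by
    rw [Polynomial.coeff_mul_add_eq_of_natDegree_le hf.1 hg.1, hf.2, hg.2]⟩

theorem HasTopCoeff.pow {f : ℂ[X]} {m : ℕ} {a : ℂ} (hf : HasTopCoeff f m a) (n : ℕ) :
    HasTopCoeff (f ^ n) (n * m) (a ^ n) :=
  ⟨Polynomial.natDegree_pow_le_of_le n hf.1, by
    rw [Polynomial.coeff_pow_of_natDegree_le hf.1, hf.2]⟩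

theorem HasTopCoeff.add {f g : ℂ[X]} {n : ℕ} {a b : ℂ} (hf : HasTopCoeff f n a)
    (hg : HasTopCoeff g n b) : HasTopCoeff (f + g) n (a + b) :=
  ⟨Polynomial.natDegree_add_le_of_degree_le hf.1 hg.1, by rw [Polynomial.coeff_add, hf.2, hg.2]⟩

theorem HasTopCoeff.neg {f : ℂ[X]} {n : ℕ} {a : ℂ} (hf : HasTopCoeff f n a) :
    HasTopCoeff (-f) n (-a) :=
  ⟨by rw [Polynomial.natDegree_neg]; exact hf.1, by rw [Polynomial.coeff_neg, hf.2]⟩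

theorem HasTopCoeff.cubicForm {f g : ℂ[X]} {n : ℕ} {a b : ℂ} (hf : HasTopCoeff f n a)
    (hg : HasTopCoeff g n b) (c : Fin 4 → ℂ) :
    HasTopCoeff (cubicForm (fun i => Polynomial.C (c i)) f g) (3 * n) (cubicForm c a b) := by
  have hC : ∀ i, HasTopCoeff (Polynomial.C (c i)) 0 (c i) := fun i => by simp [HasTopCoeff]
  refine HasTopCoeff.add (HasTopCoeff.add (HasTopCoeff.add ?_ ?_) ?_) ?_
  · convert (hC 0).mul (hf.pow 3) using 1; ring
  · convert ((hC 1).mul (hf.pow 2)).mul hg using 1; ring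
  · convert ((hC 2).mul hf).mul (hg.pow 2) using 1; ring
  · convert (hC 3).mul (hg.pow 3) using 1; ring

theorem hasTopCoeff_linear (a b : ℂ) :
    HasTopCoeff (Polynomial.C a * Polynomial.X + Polynomial.C b) 1 a :=
  ⟨by compute_degree, by simp [Polynomial.coeff_C]⟩

variable (p q r s : Fin 4 → ℂ)

/-- The form `r(-q, p) x + s(-q, p) y`. Its zeros are the points `(x, y)` for which the forms
`form31 p q` and `form13 r s` have a common zero in the remaining two coordinates. -/
def eliminant {R : Type*} [CommRing R] (p q r s : Fin 4 → R) (x y : R) : R :=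
  cubicForm r (-cubicForm q x y) (cubicForm p x y) * x +
    cubicForm s (-cubicForm q x y) (cubicForm p x y) * y

/-- The eliminant on the affine line `(a t + c, b t + d)`. -/
def eliminantPoly (a b c d : ℂ) : ℂ[X] :=
  eliminant (fun i => Polynomial.C (p i)) (fun i => Polynomial.C (q i))
    (fun i => Polynomial.C (r i)) (fun i => Polynomial.C (s i))
    (Polynomial.C a * Polynomial.X + Polynomial.C c)
    (Polynomial.C b * Polynomial.X + Polynomial.C d)

theorem eval_eliminantPoly (a b c d t : ℂ) : (eliminantPoly p q r s a b c d).eval t =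
    eliminant p q r s (a * t + c) (b * t + d) := by
  simp [eliminantPoly, eliminant, eval_cubicForm]

/-- The degree is `10 = 3 * 3 + 1`, and the top coefficient is the value of the form at the point at
infinity `(a, b)` of the affine line. -/
theorem hasTopCoeff_eliminantPoly (a b c d : ℂ) :
    HasTopCoeff (eliminantPoly p q r s a b c d) 10 (eliminant p q r s a b) := by
  have hx := hasTopCoeff_linear a c
  have hy := hasTopCoeff_linear b d
  have hp := hx.cubicForm hy p
  have hq := (hx.cubicForm hy q).neg
  exact ((hq.cubicForm hp r).mul hx).add ((hq.cubicForm hp s).mul hy)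

variable {p q r s}

/-- At a double zero the gradient of the eliminant kills both the point (Euler) and the direction
`(a, b)` of the line. These are independent because `a * d - b * c ≠ 0`, so the gradient vanishes
and `false_of_multiple_zero` applies. -/
theorem eval_derivative_eliminantPoly_ne_zero
    (hpq : ∀ a b : ℂ, cubicForm p a b = 0 → cubicForm q a b = 0 → a = 0 ∧ b = 0)
    (hs : ∀ x : Vec4, x ≠ 0 → MvPolynomial.eval x (form31 p q + form13 r s) = 0 →
      ∃ i, MvPolynomial.eval x (pderiv i (form31 p q + form13 r s)) ≠ 0)
    {a b c d : ℂ} (hdet : a * d - b * c ≠ 0) {t : ℂ}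
    (ht : (eliminantPoly p q r s a b c d).eval t = 0) :
    (Polynomial.derivative (eliminantPoly p q r s a b c d)).eval t ≠ 0 := by
  intro ht'
  rw [eval_eliminantPoly, eliminant] at ht
  simp only [eliminantPoly, eliminant, Polynomial.derivative_add, Polynomial.derivative_mul,
    derivative_cubicForm, Polynomial.derivative_neg, Polynomial.derivative_C,
    Polynomial.derivative_X, Polynomial.eval_add, Polynomial.eval_mul, eval_cubicForm,
    eval_cubicDx, eval_cubicDy, Polynomial.eval_neg, Polynomial.eval_C, Polynomial.eval_X,
    zero_mul, mul_one, zero_add, add_zero] at ht'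
  have hxy : ¬ (a * t + c = 0 ∧ b * t + d = 0) := by
    rintro ⟨h1, h2⟩
    apply hdet
    linear_combination a * h2 - b * h1
  have hdet' : a * (b * t + d) - b * (a * t + c) ≠ 0 := by convert hdet using 1; ring
  set x := a * t + c
  set y := b * t + d
  have hEp : cubicDx p x y * x + cubicDy p x y * y = 3 * cubicForm p x y := by
    simp only [cubicForm, cubicDx, cubicDy]; ring
  have hEq : cubicDx q x y * x + cubicDy q x y * y = 3 * cubicForm q x y := by
    simp only [cubicForm, cubicDx, cubicDy]; ring
  obtain ⟨P, hP⟩ : ∃ P, cubicForm p x y = P := ⟨_, rfl⟩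
  obtain ⟨Q, hQ⟩ : ∃ Q, cubicForm q x y = Q := ⟨_, rfl⟩
  rw [hP, hQ] at ht ht'
  rw [hP] at hEp
  rw [hQ] at hEq
  obtain ⟨D, hD⟩ : ∃ D, cubicDx r (-Q) P * x + cubicDx s (-Q) P * y = D := ⟨_, rfl⟩
  obtain ⟨E, hE⟩ : ∃ E, cubicDy r (-Q) P * x + cubicDy s (-Q) P * y = E := ⟨_, rfl⟩
  have hE3 : -Q * D + P * E = 0 := by
    rw [← hD, ← hE]
    simp only [cubicForm, cubicDx, cubicDy] at ht ⊢
    linear_combination 3 * ht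
  -- `Gx` and `Gy` are the partial derivatives of the eliminant, by the chain rule.
  set Gx := cubicForm r (-Q) P - D * cubicDx q x y + E * cubicDx p x y with hGx
  set Gy := cubicForm s (-Q) P - D * cubicDy q x y + E * cubicDy p x y with hGy
  have e1 : Gx * x + Gy * y = 0 := by
    rw [hGx, hGy]
    linear_combination ht - D * hEq + E * hEp + 3 * hE3
  have e2 : Gx * a + Gy * b = 0 := by
    rw [hGx, hGy, ← hD, ← hE]
    linear_combination ht'
  have hx : Gx = 0 := by
    refine (mul_eq_zero.1 (?_ : (a * y - b * x) * Gx = 0)).resolve_left hdet'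
    linear_combination y * e2 - b * e1
  have hy : Gy = 0 := by
    refine (mul_eq_zero.1 (?_ : (a * y - b * x) * Gy = 0)).resolve_left hdet'
    linear_combination a * e1 - x * e2
  exact false_of_multiple_zero hpq hs hxy hP hQ hD hE ht hx hy

/-- The eliminant has ten distinct zeros on the projective line. -/
theorem exists_ten_zeros
    (hpq : ∀ a b : ℂ, cubicForm p a b = 0 → cubicForm q a b = 0 → a = 0 ∧ b = 0)
    (hs : ∀ x : Vec4, x ≠ 0 → MvPolynomial.eval x (form31 p q + form13 r s) = 0 →
      ∃ i, MvPolynomial.eval x (pderiv i (form31 p q + form13 r s)) ≠ 0) :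
    ∃ x y : Fin 10 → ℂ, (∀ i, ¬ (x i = 0 ∧ y i = 0)) ∧
      (∀ i j, x i * y j = x j * y i → i = j) ∧ ∀ i, eliminant p q r s (x i) (y i) = 0 := by
  obtain ⟨t₀, ht₀⟩ : ∃ t, eliminant p q r s t 1 ≠ 0 := by
    by_contra! hc
    have h0 : eliminantPoly p q r s 1 0 0 1 = 0 := Polynomial.funext fun t => by
      simp [eval_eliminantPoly, hc]
    exact eval_derivative_eliminantPoly_ne_zero (a := 1) (b := 0) (c := 0) (d := 1) (t := 0)
      hpq hs (by simp) (by simp [h0]) (by simp [h0])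
  -- The parametrization `(t₀ t + 1, t)` puts the non-zero `(t₀, 1)` at infinity, so all ten zeros
  -- are at finite `t`.
  obtain ⟨hdeg, hcoeff⟩ := hasTopCoeff_eliminantPoly p q r s t₀ 1 1 0
  set g := eliminantPoly p q r s t₀ 1 1 0
  have hnat : g.natDegree = 10 :=
    le_antisymm hdeg (Polynomial.le_natDegree_of_ne_zero (by rwa [hcoeff]))
  have hsep : g.Separable := by
    rw [Polynomial.Separable, Polynomial.isCoprime_iff_aeval_ne_zero_of_isAlgClosed ℂ ℂ]
    intro t
    by_contra! ht
    simp only [Polynomial.coe_aeval_eq_eval] at ht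
    exact eval_derivative_eliminantPoly_ne_zero hpq hs (by simp) ht.1 ht.2
  have hcard : Fintype.card (g.rootSet ℂ) = 10 := by
    rw [Polynomial.card_rootSet_eq_natDegree hsep (IsAlgClosed.splits _), hnat]
  let e : Fin 10 ≃ g.rootSet ℂ := (Fintype.equivFinOfCardEq hcard).symm
  refine ⟨fun i => t₀ * e i + 1, fun i => 1 * e i + 0, fun i hi => ?_, fun i j hij => ?_,
    fun i => ?_⟩
  · have h2 : (e i : ℂ) = 0 := by simpa using hi.2
    simpa [h2] using hi.1
  · refine e.injective (Subtype.ext ?_)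
    linear_combination -hij
  · have h := (Polynomial.mem_rootSet.1 (e i).2).2
    rw [Polynomial.coe_aeval_eq_eval] at h
    rw [← eval_eliminantPoly]
    exact h

end Univariate

/-! ### Lines meeting both `l'` and `l''` -/

/-- The span of a vector in the plane `x₂ = x₃ = 0` and one in the plane `x₀ = x₁ = 0`. -/
def joinSpan (B : Vec4 ≃ₗ[ℂ] Vec4) (a b : Fin 2 → ℂ) : Submodule ℂ Vec4 :=
  Submodule.span ℂ {B ![a 0, a 1, 0, 0], B ![0, 0, b 0, b 1]}

theorem mem_joinSpan {B : Vec4 ≃ₗ[ℂ] Vec4} {a b : Fin 2 → ℂ} {v : Vec4} :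
    v ∈ joinSpan B a b ↔ ∃ s t : ℂ, v = B ![s * a 0, s * a 1, t * b 0, t * b 1] := by
  rw [joinSpan, Submodule.mem_span_pair]
  refine exists₂_congr fun s t => ?_
  rw [← map_smul, ← map_smul, ← map_add, eq_comm]
  simp

theorem finrank_joinSpan (B : Vec4 ≃ₗ[ℂ] Vec4) {a b : Fin 2 → ℂ} (ha : a ≠ 0) (hb : b ≠ 0) :
    Module.finrank ℂ (joinSpan B a b) = 2 := by
  have hli : LinearIndependent ℂ ![B ![a 0, a 1, 0, 0], B ![0, 0, b 0, b 1]] := by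
    rw [LinearIndependent.pair_iff]
    intro s t h
    rw [← map_smul, ← map_smul, ← map_add, map_eq_zero_iff B B.injective] at h
    have hs : s • a = 0 := by
      ext i; fin_cases i
      · simpa using congrFun h 0
      · simpa using congrFun h 1
    have ht : t • b = 0 := by
      ext i; fin_cases i
      · simpa using congrFun h 2
      · simpa using congrFun h 3
    exact ⟨(smul_eq_zero.1 hs).resolve_right ha, (smul_eq_zero.1 ht).resolve_right hb⟩
  have h := finrank_span_eq_card hli
  rwa [Matrix.range_cons_cons_empty] at h

theorem exists_smul_eq_of_det_eq_zero {a a' : Fin 2 → ℂ} (ha' : a' ≠ 0)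
    (h : a 0 * a' 1 = a 1 * a' 0) : ∃ c : ℂ, a = c • a' := by
  by_cases h0 : a' 0 = 0
  · have h1 : a' 1 ≠ 0 := fun h1 => ha' (by ext i; fin_cases i <;> assumption)
    refine ⟨a 1 / a' 1, ?_⟩
    rw [h0, mul_zero] at h
    ext i; fin_cases i
    · simpa [h0, h1] using h
    · simp [h1]
  · refine ⟨a 0 / a' 0, ?_⟩
    ext i; fin_cases i
    · simp [h0]
    · simp only [Fin.mk_one, Pi.smul_apply, smul_eq_mul]
      field_simp
      linear_combination -h

theorem joinSpan_le (B : Vec4 ≃ₗ[ℂ] Vec4) {a a' b b' : Fin 2 → ℂ} (ha' : a' ≠ 0) (hb' : b' ≠ 0)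
    (ha : a 0 * a' 1 = a 1 * a' 0) (hb : b 0 * b' 1 = b 1 * b' 0) :
    joinSpan B a b ≤ joinSpan B a' b' := by
  obtain ⟨c, rfl⟩ := exists_smul_eq_of_det_eq_zero ha' ha
  obtain ⟨d, rfl⟩ := exists_smul_eq_of_det_eq_zero hb' hb
  intro v hv
  obtain ⟨s, t, rfl⟩ := mem_joinSpan.1 hv
  refine mem_joinSpan.2 ⟨s * c, t * d, ?_⟩
  simp [mul_assoc]

theorem cons_left_ne_zero {a : Fin 2 → ℂ} (ha : a ≠ 0) (c d : ℂ) : ![a 0, a 1, c, d] ≠ 0 :=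
  fun h => ha (by
    ext i; fin_cases i
    · exact congrFun h 0
    · exact congrFun h 1)

theorem cons_right_ne_zero {b : Fin 2 → ℂ} (hb : b ≠ 0) (c d : ℂ) : ![c, d, b 0, b 1] ≠ 0 :=
  fun h => hb (by
    ext i; fin_cases i
    · exact congrFun h 2
    · exact congrFun h 3)

section Lines

variable {X : SmoothQuartic} {l' l'' : Set P3} (B : AdaptedCoordinates l' l'')
  {p q : Fin 4 → ℂ} {u v w : Fin 3 → ℂ} {r s : Fin 4 → ℂ}

/-- A line meeting both coordinate lines is the join of two points. -/
theorem exists_eq_joinSpan {m : Set P3} (hm : IsLine m) (h' : (m ∩ l').Nonempty)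
    (h'' : (m ∩ l'').Nonempty) : ∃ a b : Fin 2 → ℂ, a ≠ 0 ∧ b ≠ 0 ∧
      m = {z | z.submodule ≤ joinSpan B.toEquiv a b} := by
  obtain ⟨M, hM, rfl⟩ := hm
  obtain ⟨y, hyM, hyl⟩ := h'
  obtain ⟨z, hzM, hzl⟩ := h''
  induction y using Projectivization.ind with | h y hy =>
  induction z using Projectivization.ind with | h z hz =>
  obtain ⟨y, rfl⟩ := B.toEquiv.surjective y
  obtain ⟨z, rfl⟩ := B.toEquiv.surjective z
  rw [mk_mem_setOf_submodule_le] at hyM hzM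
  rw [B.mem_left] at hyl
  rw [B.mem_right] at hzl
  have hy4 : y = ![y 0, y 1, 0, 0] := by ext i; fin_cases i <;> simp [hyl]
  have hz4 : z = ![0, 0, z 2, z 3] := by ext i; fin_cases i <;> simp [hzl]
  have ha : ![y 0, y 1] ≠ 0 := fun h => hy (by
    have h0 : y 0 = 0 := congrFun h 0
    have h1 : y 1 = 0 := congrFun h 1
    rw [hy4, h0, h1, map_eq_zero_iff _ B.toEquiv.injective]
    ext i; fin_cases i <;> rfl)
  have hb : ![z 2, z 3] ≠ 0 := fun h => hz (by
    have h0 : z 2 = 0 := congrFun h 0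
    have h1 : z 3 = 0 := congrFun h 1
    rw [hz4, h0, h1, map_eq_zero_iff _ B.toEquiv.injective]
    ext i; fin_cases i <;> rfl)
  refine ⟨![y 0, y 1], ![z 2, z 3], ha, hb, ?_⟩
  have hle : joinSpan B.toEquiv ![y 0, y 1] ![z 2, z 3] ≤ M := by
    refine Submodule.span_le.2 ?_
    rintro x (rfl | rfl)
    · simpa [← hy4] using hyM
    · simpa [← hz4] using hzM
  rw [Submodule.eq_of_le_of_finrank_eq hle (by rw [finrank_joinSpan _ ha hb, hM])]

/-- On the join, the equation at `(s a, t b)` is `s³ t F₃₁ + s² t² F₂₂ + s t³ F₁₃`. Three values of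
`(s, t)` are enough to separate the parts. -/
theorem forms_eq_zero_of_joinSpan_subset
    (h : ∀ x : Vec4, eval (B.toEquiv x) X.poly =
      eval x (form31 p q + form22 u v w + form13 r s)) {a b : Fin 2 → ℂ} (ha : a ≠ 0)
    (hX : {z : P3 | z.submodule ≤ joinSpan B.toEquiv a b} ⊆ X.surface) :
    eval ![a 0, a 1, b 0, b 1] (form31 p q) = 0 ∧
      eval ![a 0, a 1, b 0, b 1] (form22 u v w) = 0 := by
  have key : ∀ s t : ℂ, s ≠ 0 → eval ![s * a 0, s * a 1, t * b 0, t * b 1] _ = 0 :=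
    fun s t hs => by
      have hne : B.toEquiv ![s * a 0, s * a 1, t * b 0, t * b 1] ≠ 0 :=
        (map_ne_zero_iff _ B.toEquiv.injective).2
          (cons_left_ne_zero (a := s • a) (smul_ne_zero hs ha) _ _)
      have := ((X.mk_mem_surface hne).1
        (hX ((mk_mem_setOf_submodule_le hne).2 (mem_joinSpan.2 ⟨s, t, rfl⟩)))).2
      exact (h _).symm.trans this
  have h1 := key 1 1 one_ne_zero
  have h2 := key 1 (-1) one_ne_zero
  have h3 := key 2 1 two_ne_zero
  simp only [map_add, eval_form31, eval_form22, eval_form13, cubicForm, quadForm,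
    Matrix.cons_val] at h1 h2 h3 ⊢
  constructor
  · linear_combination (h3 - 3 * h1 - h2) / 6
  · linear_combination (h1 + h2) / 2

/-- If ten lines on the quartic meet both coordinate lines, then the quartic has no part of
bidegree `(2, 2)`. -/
theorem form22_coeff_eq_zero_of_lines
    (h : ∀ x : Vec4, eval (B.toEquiv x) X.poly =
      eval x (form31 p q + form22 u v w + form13 r s))
    (hpq : ∀ a b : ℂ, cubicForm p a b = 0 → cubicForm q a b = 0 → a = 0 ∧ b = 0)
    {m : Fin 10 → Set P3} (hinj : Function.Injective m)
    (hm : ∀ i, IsLine (m i) ∧ m i ⊆ X.surface ∧ (m i ∩ l').Nonempty ∧ (m i ∩ l'').Nonempty) :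
    u = 0 ∧ v = 0 ∧ w = 0 := by
  choose a b ha hb hab using fun i => exists_eq_joinSpan B (hm i).1 (hm i).2.2.1 (hm i).2.2.2
  have hz := fun i => forms_eq_zero_of_joinSpan_subset B h (ha i) (hab i ▸ (hm i).2.1)
  simp only [eval_form31, eval_form22, Matrix.cons_val] at hz
  -- Distinct lines meet `l'` in distinct points: the non-trivial linear equation `F₃₁(a, b) = 0`
  -- determines `b` up to scale from `a`.
  have hdet : ∀ i j, a i 0 * a j 1 = a i 1 * a j 0 → i = j := by
    intro i j hij
    have hb' : b i 0 * b j 1 = b i 1 * b j 0 := by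
      obtain ⟨c, hc⟩ := exists_smul_eq_of_det_eq_zero (ha j) hij
      have hc0 : c ≠ 0 := by rintro rfl; exact ha i (by simpa using hc)
      have hi := (hz i).1
      have hj := (hz j).1
      have hi' : cubicForm p (a j 0) (a j 1) * b i 0 + cubicForm q (a j 0) (a j 1) * b i 1 = 0 := by
        refine (mul_eq_zero.1 (?_ : c ^ 3 * _ = 0)).resolve_left (pow_ne_zero 3 hc0)
        rw [hc] at hi
        simp only [cubicForm, Pi.smul_apply, smul_eq_mul] at hi ⊢
        linear_combination hi
      by_cases hp0 : cubicForm p (a j 0) (a j 1) = 0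
      · have hq0 : cubicForm q (a j 0) (a j 1) ≠ 0 := fun hq0 => ha j (by
          obtain ⟨h0, h1⟩ := hpq _ _ hp0 hq0
          ext k; fin_cases k <;> assumption)
        refine mul_left_cancel₀ hq0 ?_
        linear_combination b i 0 * hj - b j 0 * hi'
      · refine mul_left_cancel₀ hp0 ?_
        linear_combination b j 1 * hi' - b i 1 * hj
    apply hinj
    rw [hab i, hab j, le_antisymm (joinSpan_le B.toEquiv (ha j) (hb j) hij hb')
      (joinSpan_le B.toEquiv (ha i) (hb i) (by linear_combination -hij)
        (by linear_combination -hb'))]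
  let T : Finset (Fin 10) := Finset.univ.filter fun i => a i 1 ≠ 0
  have hT : 9 ≤ T.card := by
    -- At most one line passes through the point at infinity of `l'`, which leaves nine affine
    -- parameters.
    have h1 : (Finset.univ.filter fun i => ¬ a i 1 ≠ 0).card ≤ 1 := by
      rw [Finset.card_le_one]
      intro i hi j hj
      simp only [Finset.mem_filter, Finset.mem_univ, true_and, not_not] at hi hj
      exact hdet i j (by rw [hi, hj]; ring)
    have h2 := Finset.card_filter_add_card_filter_not (s := (Finset.univ : Finset (Fin 10)))
      fun i => a i 1 ≠ 0
    rw [Finset.card_univ, Fintype.card_fin] at h2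
    change 9 ≤ (Finset.univ.filter fun i => a i 1 ≠ 0).card
    omega
  refine form22_coeff_eq_zero hpq (T.image fun i => a i 0 / a i 1) ?_ ?_
  · rw [Finset.card_image_of_injOn]
    · exact hT
    · intro i hi j hj hij
      have hi' : a i 1 ≠ 0 := (Finset.mem_filter.1 hi).2
      have hj' : a j 1 ≠ 0 := (Finset.mem_filter.1 hj).2
      simp only at hij
      field_simp at hij
      exact hdet i j (by linear_combination hij)
  · intro t ht
    obtain ⟨i, hi, rfl⟩ := Finset.mem_image.1 ht
    have hi' : a i 1 ≠ 0 := (Finset.mem_filter.1 hi).2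
    obtain ⟨t, ht⟩ : ∃ t, a i 0 / a i 1 = t := ⟨_, rfl⟩
    rw [ht]
    have ht' : a i 0 = t * a i 1 := by rw [← ht]; field_simp
    obtain ⟨h31, h22⟩ := hz i
    rw [ht'] at h31 h22
    have h31' : cubicForm p t 1 * b i 0 + cubicForm q t 1 * b i 1 = 0 := by
      refine (mul_eq_zero.1 (?_ : a i 1 ^ 3 * _ = 0)).resolve_left (pow_ne_zero 3 hi')
      simp only [cubicForm] at h31 ⊢
      linear_combination h31
    have h22' : quadForm u t 1 * b i 0 ^ 2 + quadForm v t 1 * (b i 0 * b i 1) +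
        quadForm w t 1 * b i 1 ^ 2 = 0 := by
      refine (mul_eq_zero.1 (?_ : a i 1 ^ 2 * _ = 0)).resolve_left (pow_ne_zero 2 hi')
      simp only [quadForm] at h22 ⊢
      linear_combination h22
    generalize cubicForm p t 1 = P at *
    generalize cubicForm q t 1 = Q at *
    generalize quadForm u t 1 = U at *
    generalize quadForm v t 1 = V at *
    generalize quadForm w t 1 = W at *
    -- By `h31'`, `b i` is proportional to `(-Q, P)`; substituting this in `h22'` costs the square
    -- of a non-zero coordinate of `b i`.
    by_cases hb0 : b i 0 = 0
    · have hb1 : b i 1 ≠ 0 := fun hb1 => hb i (by ext k; fin_cases k <;> assumption)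
      refine (mul_eq_zero.1 (?_ : b i 1 ^ 2 * _ = 0)).resolve_left (pow_ne_zero 2 hb1)
      linear_combination P ^ 2 * h22' +
        (U * (Q * b i 1 - P * b i 0) - V * P * b i 1) * h31'
    · refine (mul_eq_zero.1 (?_ : b i 0 ^ 2 * _ = 0)).resolve_left (pow_ne_zero 2 hb0)
      linear_combination Q ^ 2 * h22' +
        (W * (P * b i 0 - Q * b i 1) - V * Q * b i 0) * h31'

/-- A smooth quartic without part of bidegree `(2, 2)` contains ten lines meeting both coordinate
lines. -/
theorem areTwinLines_of_bihomogeneous (hl' : IsLine l') (hl'' : IsLine l'')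
    (hX' : l' ⊆ X.surface) (hX'' : l'' ⊆ X.surface) (hdisj : Disjoint l' l'')
    (h : ∀ x : Vec4, eval (B.toEquiv x) X.poly = eval x (form31 p q + form13 r s))
    (hpq : ∀ a b : ℂ, cubicForm p a b = 0 → cubicForm q a b = 0 → a = 0 ∧ b = 0) :
    X.AreTwinLines l' l'' := by
  obtain ⟨x, y, hne, hdet, hz⟩ := exists_ten_zeros hpq
    fun x hx => X.smooth_coordinates B.toEquiv h hx
  let a : Fin 10 → Fin 2 → ℂ := fun i => ![x i, y i]
  let b : Fin 10 → Fin 2 → ℂ := fun i => ![-cubicForm q (x i) (y i), cubicForm p (x i) (y i)]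
  have ha : ∀ i, a i ≠ 0 := fun i hi => hne i ⟨congrFun hi 0, congrFun hi 1⟩
  have hb : ∀ i, b i ≠ 0 := fun i hi =>
    hne i (hpq _ _ (congrFun hi 1) (neg_eq_zero.1 (congrFun hi 0)))
  have hA : ∀ i, B.toEquiv ![a i 0, a i 1, 0, 0] ≠ 0 := fun i =>
    (map_ne_zero_iff _ B.toEquiv.injective).2 (cons_left_ne_zero (ha i) _ _)
  have hB : ∀ i, B.toEquiv ![0, 0, b i 0, b i 1] ≠ 0 := fun i =>
    (map_ne_zero_iff _ B.toEquiv.injective).2 (cons_right_ne_zero (hb i) _ _)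
  let m : Fin 10 → Set P3 := fun i => {z | z.submodule ≤ joinSpan B.toEquiv (a i) (b i)}
  have hAm : ∀ i, Projectivization.mk ℂ _ (hA i) ∈ m i := fun i =>
    (mk_mem_setOf_submodule_le _).2 (mem_joinSpan.2 ⟨1, 0, by simp⟩)
  have hBm : ∀ i, Projectivization.mk ℂ _ (hB i) ∈ m i := fun i =>
    (mk_mem_setOf_submodule_le _).2 (mem_joinSpan.2 ⟨0, 1, by simp⟩)
  have hAl : ∀ i, Projectivization.mk ℂ _ (hA i) ∈ l' := fun i =>
    (B.mem_left _ _).2 ⟨rfl, rfl⟩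
  have hBl : ∀ i, Projectivization.mk ℂ _ (hB i) ∈ l'' := fun i =>
    (B.mem_right _ _).2 ⟨rfl, rfl⟩
  refine ⟨hl', hl'', hX', hX'', hdisj, m, fun i j hij => ?_, fun i =>
    ⟨⟨_, finrank_joinSpan _ (ha i) (hb i), rfl⟩, fun z hzm => ?_, fun he => ?_, fun he => ?_,
      ⟨_, hAm i, hAl i⟩, ⟨_, hBm i, hBl i⟩⟩⟩
  · have h1 : Projectivization.mk ℂ _ (hA i) ∈ m j := hij ▸ hAm i
    obtain ⟨c, d, hcd⟩ := mem_joinSpan.1 ((mk_mem_setOf_submodule_le _).1 h1)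
    have h2 := B.toEquiv.injective hcd
    have hx : x i = c * x j := congrFun h2 0
    have hy : y i = c * y j := congrFun h2 1
    exact hdet i j (by rw [hx, hy]; ring)
  · induction z using Projectivization.ind with | h z hz0 =>
    rw [X.mk_mem_surface]
    obtain ⟨c, d, rfl⟩ := mem_joinSpan.1 ((mk_mem_setOf_submodule_le _).1 hzm)
    refine ⟨hz0, ?_⟩
    have hzi := hz i
    rw [h, map_add, eval_form31, eval_form13]
    simp only [Matrix.cons_val, a, b, eliminant, cubicForm] at hzi ⊢
    linear_combination c * d ^ 3 * hzi
  · have h1 := hBm i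
    rw [he] at h1
    exact Set.disjoint_left.1 hdisj h1 (hBl i)
  · have h1 := hAm i
    rw [he] at h1
    exact Set.disjoint_left.1 hdisj (hAl i) h1

end Lines

/-! ### The residue 2-form -/

/-- The alternating form `(w₀, w₁) ↦ det (v, n, w₀, w₁)`. -/
def detForm (v n : Vec4) : Vec4 [⋀^Fin 2]→ₗ[ℂ] ℂ :=
  ((Pi.basisFun ℂ (Fin 4)).det.curryLeft v).curryLeft n

theorem detForm_apply (v n : Vec4) (w : Fin 2 → Vec4) : detForm v n w =
    (Pi.basisFun ℂ (Fin 4)).det (Matrix.vecCons v (Matrix.vecCons n w)) := rfl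

theorem detForm_map (A : Vec4 →ₗ[ℂ] Vec4) (v n : Vec4) (w : Fin 2 → Vec4) :
    detForm (A v) (A n) (fun i => A (w i)) = LinearMap.det A * detForm v n w := by
  rw [detForm_apply, detForm_apply, ← Module.Basis.det_comp]
  congr 1
  ext i : 1
  refine Fin.cases rfl (fun i => ?_) i
  exact Fin.cases rfl (fun _ => rfl) i

theorem detForm_sub_smul (v n n' : Vec4) (a b : ℂ) (w : Fin 2 → Vec4) :
    detForm v (a • n - b • n') w = a * detForm v n w - b * detForm v n' w := by
  simp [detForm, sub_eq_add_neg, ← neg_smul]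

/-- Four vectors in a hyperplane are linearly dependent. -/
theorem detForm_eq_zero_of_ker {f : Vec4 →ₗ[ℂ] ℂ} (hf : f ≠ 0) {v n : Vec4} {w : Fin 2 → Vec4}
    (hv : f v = 0) (hn : f n = 0) (hw : ∀ i, f (w i) = 0) : detForm v n w = 0 := by
  rw [detForm_apply]
  refine AlternatingMap.map_linearDependent _ _ fun hli => hf ?_
  have htop := hli.span_eq_top_of_card_eq_finrank (by simp)
  refine LinearMap.ker_eq_top.1 (top_le_iff.1 (htop ▸ Submodule.span_le.2 ?_))
  rintro _ ⟨i, rfl⟩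
  refine Fin.cases hv (fun i => ?_) i
  exact Fin.cases hn hw i

/-- `det (v, n, w₀, w₁) / f n` does not depend on `n` if `v, w₀, w₁ ∈ ker f`. -/
theorem detForm_div_eq {f : Vec4 →ₗ[ℂ] ℂ} {v n n' : Vec4} {w : Fin 2 → Vec4}
    (hn : f n ≠ 0) (hn' : f n' ≠ 0) (hv : f v = 0) (hw : ∀ i, f (w i) = 0) :
    (f n)⁻¹ * detForm v n w = (f n')⁻¹ * detForm v n' w := by
  have h := detForm_eq_zero_of_ker (f := f) (n := f n' • n - f n • n') (fun h => hn (by simp [h]))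
    hv (by simp [mul_comm]) hw
  rw [detForm_sub_smul] at h
  field_simp
  linear_combination h

/-- Complete `v` to a basis of the three-dimensional kernel of `f`; adding `n`, which lies outside
the kernel, gives a basis of `ℂ⁴`. -/
theorem exists_detForm_ne_zero {f : Vec4 →ₗ[ℂ] ℂ} {v n : Vec4} (hn : f n ≠ 0) (hv : f v = 0)
    (hv0 : v ≠ 0) : ∃ w : Fin 2 → Vec4, (∀ i, f (w i) = 0) ∧ detForm v n w ≠ 0 := by
  have hrank : Module.finrank ℂ (LinearMap.ker f) = 3 := by
    have h1 : f.range = ⊤ := LinearMap.range_eq_top.2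
      (LinearMap.surjective (by rintro rfl; exact hn rfl))
    have h2 := f.finrank_range_add_finrank_ker
    rw [h1, finrank_top, Module.finrank_self, Module.finrank_fin_fun] at h2
    omega
  have li1 : LinearIndependent ℂ ![(⟨v, hv⟩ : LinearMap.ker f)] :=
    LinearIndependent.of_subsingleton 0 fun h => hv0 (congrArg Subtype.val h)
  obtain ⟨a, li2⟩ := exists_linearIndependent_cons_of_lt_finrank li1 (by rw [hrank]; norm_num)
  obtain ⟨b, li3⟩ := exists_linearIndependent_cons_of_lt_finrank li2 (by rw [hrank]; norm_num)
  have li3' := li3.map' (LinearMap.ker f).subtype (Submodule.ker_subtype _)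
  have li4 : LinearIndependent ℂ (Fin.cons n ((LinearMap.ker f).subtype ∘ Fin.cons b
      (Fin.cons a ![(⟨v, hv⟩ : LinearMap.ker f)])) : Fin 4 → Vec4) := by
    refine linearIndependent_finCons.2 ⟨li3', fun hmem => hn ?_⟩
    refine (Submodule.span_le (p := LinearMap.ker f)).2 ?_ hmem
    rintro _ ⟨i, rfl⟩
    exact Subtype.mem _
  have li := li4.comp ![3, 0, 2, 1] (by decide)
  refine ⟨![a, b], fun i => ?_, ?_⟩
  · fin_cases i
    · exact a.2
    · exact b.2
  · rw [detForm_apply]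
    refine IsUnit.ne_zero ((Module.Basis.is_basis_iff_det _).1 ?_)
    have he : Matrix.vecCons v (Matrix.vecCons n ![(a : Vec4), b]) =
        (Fin.cons n ((LinearMap.ker f).subtype ∘ Fin.cons b
          (Fin.cons a ![(⟨v, hv⟩ : LinearMap.ker f)])) : Fin 4 → Vec4) ∘ ![3, 0, 2, 1] := by
      ext i : 1
      fin_cases i <;> rfl
    rw [he]
    exact ⟨li, li.span_eq_top_of_card_eq_finrank (by simp)⟩

theorem differentiable_detForm (n : Vec4) (w : Fin 2 → Vec4) :
    Differentiable ℂ fun x => detForm x n w := by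
  let T : Vec4 →ₗ[ℂ] ℂ :=
    { toFun := fun x => detForm x n w
      map_add' := fun x y => by simp [detForm]
      map_smul' := fun c x => by simp [detForm] }
  exact (LinearMap.toContinuousLinearMap T).differentiable

theorem polyDiff_single (F : MvPolynomial (Fin 4) ℂ) (v : Vec4) (i : Fin 4) :
    polyDiff F v (Pi.single i 1) = eval v (pderiv i F) := by
  simp [polyDiff_apply, Pi.single_apply]

theorem differentiable_eval (F : MvPolynomial (Fin 4) ℂ) :
    Differentiable ℂ fun x : Vec4 => eval x F :=
  fun x => (hasStrictFDerivAt_eval F x).hasFDerivAt.differentiableAt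

namespace SmoothQuartic

variable (X : SmoothQuartic)

theorem polyDiff_self {v : Vec4} (hv : v ∈ X.cone) : polyDiff X.poly v v = 0 := by
  have h := X.homogeneous.sum_X_mul_pderiv
  have h' := congrArg (eval v) h
  simp only [map_sum, map_mul, eval_X, map_nsmul, hv.2, smul_zero] at h'
  rw [polyDiff_apply, ← h']
  exact Finset.sum_congr rfl fun i _ => mul_comm _ _

theorem exists_index (v : X.cone) : ∃ i, polyDiff X.poly v (Pi.single i 1) ≠ 0 := by
  simpa only [polyDiff_single] using X.smooth v v.2.1 v.2.2

/-- The residue on the cone of the meromorphic form `Ω / F`, where `Ω` is the contraction of the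
volume form of `ℂ⁴` with the radial vector field. -/
def residueForm (v : X.cone) : X.tangent v [⋀^Fin 2]→ₗ[ℂ] ℂ :=
  (polyDiff X.poly v (Pi.single (X.exists_index v).choose 1))⁻¹ •
    (detForm v (Pi.single (X.exists_index v).choose 1)).compLinearMap (X.tangent v).subtype

theorem residueForm_apply {v : X.cone} {n : Vec4} (hn : polyDiff X.poly v n ≠ 0)
    (w : Fin 2 → X.tangent v) :
    X.residueForm v w = (polyDiff X.poly v n)⁻¹ * detForm v n (fun i => (w i : Vec4)) :=
  detForm_div_eq (f := polyDiff X.poly v) (X.exists_index v).choose_spec hn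
    (X.polyDiff_self v.2) fun i => (w i).2

theorem residueForm_map (A : Vec4 ≃ₗ[ℂ] Vec4) {k : ℂ} (hk : k ≠ 0)
    (hA : ∀ x, eval (A x) X.poly = k * eval x X.poly) {v v' : X.cone} (hv : (v' : Vec4) = A v)
    {w : Fin 2 → X.tangent v} {w' : Fin 2 → X.tangent v'}
    (hw : ∀ i, (w' i : Vec4) = A (w i : Vec4)) :
    X.residueForm v' w' = LinearMap.det A.toLinearMap / k * X.residueForm v w := by
  obtain ⟨i, hi⟩ := X.exists_index v
  have hd : polyDiff X.poly v' (A (Pi.single i 1)) = k * polyDiff X.poly v (Pi.single i 1) := by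
    rw [hv]; exact polyDiff_of_eval_comp A.toLinearMap k hA _ _
  have hm := detForm_map A.toLinearMap v (Pi.single i 1) fun i => (w i : Vec4)
  simp only [LinearEquiv.coe_coe] at hm
  rw [X.residueForm_apply hi, X.residueForm_apply (n := A (Pi.single i 1))
    (by rw [hd]; exact mul_ne_zero hk hi), hd]
  simp only [hv, hw, hm]
  field_simp

/-- Invariance under scaling by `c` is where the degree 4 enters: the determinant on `ℂ⁴` and the
quartic both scale by `c ^ 4`. Locally one fixed basis vector stays transversal, which gives the
holomorphic extension. -/
theorem residueForm_mem_H20 : X.residueForm ∈ X.H20 := by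
  refine ⟨fun v w hw => ?_, fun c v v' hv w w' hw => ?_, fun v₀ => ?_⟩
  · obtain ⟨i, hi⟩ := X.exists_index v
    rw [X.residueForm_apply hi, detForm_apply]
    rw [AlternatingMap.map_eq_zero_of_eq _ _ (i := 0) (j := 2) hw.symm (by decide), mul_zero]
  · have hc : c ≠ 0 := by rintro rfl; exact v'.2.1 (by rw [hv, zero_smul])
    have hc4 : c ^ 4 ≠ 0 := pow_ne_zero 4 hc
    rw [X.residueForm_map (LinearEquiv.smulOfNeZero ℂ Vec4 c hc) hc4
      (fun x => eval_smul_of_isHomogeneous X.homogeneous c x) hv hw]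
    have hdet : LinearMap.det (LinearEquiv.smulOfNeZero ℂ Vec4 c hc).toLinearMap = c ^ 4 := by
      have : (LinearEquiv.smulOfNeZero ℂ Vec4 c hc).toLinearMap = c • LinearMap.id := rfl
      rw [this, LinearMap.det_smul]; simp
    rw [hdet, div_self hc4, one_mul]
  · obtain ⟨i, hi⟩ := X.exists_index v₀
    refine ⟨{x | polyDiff X.poly x (Pi.single i 1) ≠ 0}, ?_, hi,
      fun x => (polyDiff X.poly x (Pi.single i 1))⁻¹ • detForm x (Pi.single i 1),
      fun w => ?_, fun v hv w => X.residueForm_apply hv w⟩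
    · simp only [polyDiff_single]
      exact isOpen_ne_fun (differentiable_eval _).continuous continuous_const
    · refine DifferentiableOn.mul (DifferentiableOn.inv ?_ fun x hx => hx)
        (differentiable_detForm _ _).differentiableOn
      simp only [polyDiff_single]
      exact (differentiable_eval _).differentiableOn

theorem exists_residueForm_ne_zero (v : X.cone) : ∃ w, X.residueForm v w ≠ 0 := by
  obtain ⟨i, hi⟩ := X.exists_index v
  obtain ⟨w, hw, hne⟩ := exists_detForm_ne_zero hi (X.polyDiff_self v.2) v.2.1
  refine ⟨fun i => ⟨w i, hw i⟩, ?_⟩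
  rw [X.residueForm_apply hi]
  exact mul_ne_zero (inv_ne_zero hi) hne

/-- A symmetry with a lift of determinant `1` that changes the sign of the equation is not
symplectic. -/
theorem not_isSymplectic {X : SmoothQuartic} (τ : X.Symmetry) (A : Vec4 ≃ₗ[ℂ] Vec4)
    (hA : τ.IsLift A) (hdet : LinearMap.det A.toLinearMap = 1)
    (hF : ∀ x, eval (A x) X.poly = -eval x X.poly) (hX : X.cone.Nonempty) :
    ¬ τ.IsSymplectic := by
  intro h
  obtain ⟨v, hv⟩ := hX
  obtain ⟨w, hw⟩ := X.exists_residueForm_ne_zero ⟨v, hv⟩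
  have h1 := congrArg (fun T => (T ⟨X.residueForm, X.residueForm_mem_H20⟩).1 ⟨v, hv⟩ w) (h A hA)
  have h2 := X.residueForm_map A (k := -1) (by simp) (by simpa using hF) (v := ⟨v, hv⟩)
    (v' := ⟨A v, hA.map_mem_cone v hv⟩) rfl (w := w)
    (w' := fun i => X.tangentMap A hA.map_mem_cone ⟨v, hv⟩ (w i)) fun i => rfl
  have h3 : X.residueForm ⟨A v, hA.map_mem_cone v hv⟩
      (fun i => X.tangentMap A hA.map_mem_cone ⟨v, hv⟩ (w i)) = X.residueForm ⟨v, hv⟩ w := h1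
  rw [h3, hdet] at h2
  apply hw
  linear_combination h2 / 2

end SmoothQuartic

/-! ### Symmetries fixing exactly the two lines -/

/-- The involution `diag (1, 1, -1, -1)` of `ℂ⁴`. -/
def signInvolution : Vec4 ≃ₗ[ℂ] Vec4 :=
  LinearEquiv.ofInvolutive (Matrix.toLin' (Matrix.diagonal ![1, 1, -1, -1])) fun x => by
    ext i; fin_cases i <;> simp [Matrix.mulVec_diagonal]

theorem signInvolution_apply (x : Vec4) : signInvolution x = ![x 0, x 1, -x 2, -x 3] := by
  change Matrix.toLin' (Matrix.diagonal ![1, 1, -1, -1]) x = _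
  ext i; fin_cases i <;> simp [Matrix.mulVec_diagonal]

theorem det_signInvolution : LinearMap.det signInvolution.toLinearMap = 1 := by
  change LinearMap.det (Matrix.toLin' (Matrix.diagonal (![1, 1, -1, -1] : Vec4))) = 1
  simp [LinearMap.det_toLin', Matrix.det_diagonal, Fin.prod_univ_four]

/-- A point is fixed by a linear map if its representatives are eigenvectors. -/
theorem smul_mk_eq_self_iff (A : Vec4 ≃ₗ[ℂ] Vec4) {v : Vec4} (hv : v ≠ 0) :
    A • Projectivization.mk ℂ v hv = Projectivization.mk ℂ v hv ↔ ∃ c : ℂ, A v = c • v := by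
  rw [Projectivization.smul_mk, Projectivization.mk_eq_mk_iff']
  exact exists_congr fun c => eq_comm

section Symmetry

variable {X : SmoothQuartic} {l' l'' : Set P3} (B : AdaptedCoordinates l' l'')

theorem SmoothQuartic.Symmetry.fixX_eq_inter (τ : X.Symmetry) : τ.fixX = τ.fixP3 ∩ X.surface := by
  ext z
  constructor
  · rintro ⟨x, hx, rfl⟩
    exact ⟨congrArg Subtype.val hx, x.2⟩
  · rintro ⟨hz, hzX⟩
    exact ⟨⟨z, hzX⟩, Subtype.ext hz, rfl⟩

/-- Both remaining parts have odd degree in `(x₂, x₃)`, so the sign involution negates the equation.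
The line `m` supplies a point of `X` off `l' ∪ l''`, which shows that the involution is not the
identity on `X`. -/
theorem exists_symmetry_of_bihomogeneous {p q r s : Fin 4 → ℂ}
    (hX' : l' ⊆ X.surface) (hX'' : l'' ⊆ X.surface)
    (h : ∀ x : Vec4, eval (B.toEquiv x) X.poly = eval x (form31 p q + form13 r s))
    {m : Set P3} (hm : IsLine m) (hmX : m ⊆ X.surface) (hm' : (m ∩ l').Nonempty)
    (hm'' : (m ∩ l'').Nonempty) :
    ∃ τ : X.Symmetry, ¬ τ.IsSymplectic ∧ orderOf τ.onSurface = 2 ∧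
      τ.fixX = l' ∪ l'' ∧ τ.fixP3 = l' ∪ l'' := by
  let A : Vec4 ≃ₗ[ℂ] Vec4 := (B.toEquiv.symm.trans signInvolution).trans B.toEquiv
  have hA : ∀ x, A (B.toEquiv x) = B.toEquiv (signInvolution x) := fun x => by simp [A]
  have hAA : ∀ v, A (A v) = v := fun v => by
    obtain ⟨x, rfl⟩ := B.toEquiv.surjective v
    rw [hA, hA, signInvolution_apply, signInvolution_apply]
    congr 1
    ext i; fin_cases i <;> simp
  have hF : ∀ v, eval (A v) X.poly = -eval v X.poly := fun v => by
    obtain ⟨x, rfl⟩ := B.toEquiv.surjective v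
    rw [hA, h, h, signInvolution_apply]
    simp only [map_add, eval_form31, eval_form13, cubicForm, Matrix.cons_val]
    ring
  have hdet : LinearMap.det A.toLinearMap = 1 := by
    rw [← det_signInvolution]
    exact LinearMap.det_conj signInvolution.toLinearMap B.toEquiv
  let τ : X.Symmetry :=
    { aut := MulAction.toPermHom (Vec4 ≃ₗ[ℂ] Vec4) P3 A
      aut_mem := ⟨A, rfl⟩
      preserves := fun z => by
        induction z using Projectivization.ind with | h v hv =>
        change A • Projectivization.mk ℂ v hv ∈ X.surface ↔ _
        rw [Projectivization.smul_mk, X.mk_mem_surface, X.mk_mem_surface]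
        change (A v ≠ 0 ∧ eval (A v) X.poly = 0) ↔ v ≠ 0 ∧ eval v X.poly = 0
        rw [hF, neg_eq_zero, map_ne_zero_iff _ A.injective] }
  have hlift : τ.IsLift A := fun _ => rfl
  have hfix : τ.fixP3 = l' ∪ l'' := by
    ext z
    induction z using Projectivization.ind with | h v hv =>
    obtain ⟨x, rfl⟩ := B.toEquiv.surjective v
    change A • Projectivization.mk ℂ (B.toEquiv x) hv = _ ↔ _
    rw [smul_mk_eq_self_iff, Set.mem_union, B.mem_left, B.mem_right, hA]
    constructor
    · rintro ⟨c, hc⟩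
      rw [← map_smul, signInvolution_apply] at hc
      have hc' := B.toEquiv.injective hc
      have h0 : x 0 = c * x 0 := congrFun hc' 0
      have h1 : x 1 = c * x 1 := congrFun hc' 1
      have h2 : -x 2 = c * x 2 := congrFun hc' 2
      have h3 : -x 3 = c * x 3 := congrFun hc' 3
      by_cases hc1 : c = 1
      · left
        rw [hc1] at h2 h3
        exact ⟨by linear_combination -h2 / 2, by linear_combination -h3 / 2⟩
      · right
        have hc2 : 1 - c ≠ 0 := sub_ne_zero.2 (Ne.symm hc1)
        exact ⟨(mul_eq_zero.1 (by linear_combination h0 : (1 - c) * x 0 = 0)).resolve_left hc2,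
          (mul_eq_zero.1 (by linear_combination h1 : (1 - c) * x 1 = 0)).resolve_left hc2⟩
    · rintro (⟨h2, h3⟩ | ⟨h0, h1⟩)
      · refine ⟨1, ?_⟩
        rw [one_smul, signInvolution_apply]
        congr 1
        ext i; fin_cases i <;> simp [h2, h3]
      · refine ⟨-1, ?_⟩
        rw [← map_smul, signInvolution_apply]
        congr 1
        ext i; fin_cases i <;> simp [h0, h1]
  have hfixX : τ.fixX = l' ∪ l'' := by
    rw [τ.fixX_eq_inter, hfix, Set.inter_eq_left]
    exact Set.union_subset hX' hX''
  obtain ⟨a, b, ha, hb, rfl⟩ := exists_eq_joinSpan B hm hm' hm''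
  have hv : B.toEquiv ![a 0, a 1, b 0, b 1] ≠ 0 :=
    (map_ne_zero_iff _ B.toEquiv.injective).2 (cons_left_ne_zero ha _ _)
  have hvX : Projectivization.mk ℂ _ hv ∈ X.surface :=
    hmX ((mk_mem_setOf_submodule_le hv).2 (mem_joinSpan.2 ⟨1, 1, by simp⟩))
  refine ⟨τ, X.not_isSymplectic τ A hlift hdet hF ⟨_, (X.mk_mem_surface hv).1 hvX⟩, ?_,
    hfixX, hfix⟩
  refine orderOf_eq_prime ?_ fun h1 => ?_
  · ext ⟨z, hz⟩
    induction z using Projectivization.ind with | h v hv =>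
    change A • A • Projectivization.mk ℂ v hv = Projectivization.mk ℂ v hv
    rw [Projectivization.smul_mk, Projectivization.smul_mk]
    congr 1
    exact hAA v
  · have hmem : Projectivization.mk ℂ _ hv ∈ τ.fixX := ⟨⟨_, hvX⟩, by
      change τ.onSurface _ = _
      rw [h1]; rfl, rfl⟩
    rw [hfixX, Set.mem_union, B.mem_left, B.mem_right] at hmem
    rcases hmem with ⟨h0, h1⟩ | ⟨h0, h1⟩
    · exact hb (by ext i; fin_cases i <;> assumption)
    · exact ha (by ext i; fin_cases i <;> assumption)

/-- In adapted coordinates, a projectivity whose fixed points are two lines is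
`diag (α, α, β, β)`. -/
theorem exists_scalars_of_fixP3_eq (τ : X.Symmetry) (hfix : τ.fixP3 = l' ∪ l'')
    {A : Vec4 ≃ₗ[ℂ] Vec4} (hA : τ.IsLift A) : ∃ α β : ℂ, α ≠ 0 ∧ β ≠ 0 ∧ α ≠ β ∧
      ∀ x, A (B.toEquiv x) = B.toEquiv ![α * x 0, α * x 1, β * x 2, β * x 3] := by
  have hiff : ∀ x, B.toEquiv x ≠ 0 → ((∃ c : ℂ, A (B.toEquiv x) = c • B.toEquiv x) ↔
      (x 2 = 0 ∧ x 3 = 0) ∨ (x 0 = 0 ∧ x 1 = 0)) := by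
    intro x hx
    rw [← smul_mk_eq_self_iff A hx, ← B.mem_left x hx, ← B.mem_right x hx, ← hA, ← Set.mem_union,
      ← hfix]
    rfl
  let T : Vec4 ≃ₗ[ℂ] Vec4 := (B.toEquiv.trans A).trans B.toEquiv.symm
  have hT : ∀ x, A (B.toEquiv x) = B.toEquiv (T x) := fun x => by simp [T]
  have hiff' : ∀ x, x ≠ 0 → ((∃ c : ℂ, T x = c • x) ↔
      (x 2 = 0 ∧ x 3 = 0) ∨ (x 0 = 0 ∧ x 1 = 0)) := by
    intro x hx
    rw [← hiff x ((map_ne_zero_iff _ B.toEquiv.injective).2 hx)]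
    simp only [hT, ← map_smul, B.toEquiv.injective.eq_iff]
  -- All points of `l'` are fixed, so two basis vectors and their sum are eigenvectors, which makes
  -- the eigenvalues equal; likewise on `l''`.
  obtain ⟨α, h0⟩ := (hiff' ![1, 0, 0, 0] (fun h => by simpa using congrFun h 0)).2 (by simp)
  obtain ⟨α', h1⟩ := (hiff' ![0, 1, 0, 0] (fun h => by simpa using congrFun h 1)).2 (by simp)
  obtain ⟨γ, h01⟩ := (hiff' ![1, 1, 0, 0] (fun h => by simpa using congrFun h 1)).2 (by simp)
  obtain ⟨β, h2⟩ := (hiff' ![0, 0, 1, 0] (fun h => by simpa using congrFun h 2)).2 (by simp)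
  obtain ⟨β', h3⟩ := (hiff' ![0, 0, 0, 1] (fun h => by simpa using congrFun h 3)).2 (by simp)
  obtain ⟨δ, h23⟩ := (hiff' ![0, 0, 1, 1] (fun h => by simpa using congrFun h 3)).2 (by simp)
  have hTx : ∀ x, T x = ![α * x 0, α' * x 1, β * x 2, β' * x 3] := by
    intro x
    have hx : x = x 0 • ![1, 0, 0, 0] + x 1 • ![0, 1, 0, 0] + x 2 • ![0, 0, 1, 0] +
        x 3 • ![0, 0, 0, 1] := by ext i; fin_cases i <;> simp
    conv_lhs => rw [hx]
    simp only [map_add, map_smul, h0, h1, h2, h3]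
    ext i; fin_cases i <;> simp [mul_comm]
  rw [hTx] at h01 h23
  have hα : α' = α := by
    have e0 := congrFun h01 0
    have e1 := congrFun h01 1
    simp at e0 e1
    rw [e0, e1]
  have hβ : β' = β := by
    have e0 := congrFun h23 2
    have e1 := congrFun h23 3
    simp at e0 e1
    rw [e0, e1]
  rw [hα, hβ] at hTx
  refine ⟨α, β, ?_, ?_, ?_, fun x => by rw [hT, hTx]⟩
  · rintro rfl
    rw [zero_smul, map_eq_zero_iff _ T.injective] at h0
    simpa using congrFun h0 0
  · rintro rfl
    rw [zero_smul, map_eq_zero_iff _ T.injective] at h2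
    simpa using congrFun h2 2
  -- With `α = β` the point `(1, 0, 1, 0)`, on neither line, would be fixed.
  · rintro rfl
    have := (hiff' ![1, 0, 1, 0] (fun h => by simpa using congrFun h 0)).1
      ⟨α, by rw [hTx]; ext i; fin_cases i <;> simp⟩
    simp at this

/-- If a quadratic polynomial `c z ^ 2 + b z + a` with `a, c ≠ 0` has a root set that is stable
under multiplication by some `ρ ≠ 1`, then `b = 0`. -/
theorem middle_coeff_eq_zero_of_roots_stable {a b c ρ : ℂ} (ha : a ≠ 0) (hc : c ≠ 0) (hρ : ρ ≠ 1)
    (h : ∀ z, a + b * z + c * z ^ 2 = 0 → a + b * (ρ * z) + c * (ρ * z) ^ 2 = 0) : b = 0 := by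
  obtain ⟨z, hz⟩ : ∃ z, a + b * z + c * z ^ 2 = 0 := by
    obtain ⟨d, hd⟩ := IsAlgClosed.exists_pow_nat_eq (b ^ 2 - 4 * a * c) two_pos
    refine ⟨(d - b) / (2 * c), ?_⟩
    field_simp
    linear_combination hd
  have hz0 : z ≠ 0 := by rintro rfl; exact ha (by simpa using hz)
  -- `z`, `ρ z` and `ρ² z` are all roots. Comparing the root sums of the two consecutive pairs gives
  -- `ρ = -1`, so the sum of the roots is 0.
  have h1 := h z hz
  have h2 := h _ h1
  have hρ' : ρ - 1 ≠ 0 := sub_ne_zero.2 hρ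
  have hzρ : (ρ - 1) * z ≠ 0 := mul_ne_zero hρ' hz0
  have e1 : b + c * z * (ρ + 1) = 0 := by
    refine (mul_eq_zero.1 (?_ : (ρ - 1) * z * _ = 0)).resolve_left hzρ
    linear_combination h1 - hz
  by_cases hρ0 : ρ = 0
  · rw [hρ0] at h1
    exact absurd (by simpa using h1) ha
  have e2 : b + c * (ρ * z) * (ρ + 1) = 0 := by
    refine (mul_eq_zero.1 (?_ : ρ * ((ρ - 1) * z) * _ = 0)).resolve_left (mul_ne_zero hρ0 hzρ)
    linear_combination h2 - h1
  have e3 : ρ + 1 = 0 := by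
    refine (mul_eq_zero.1 (?_ : c * ((ρ - 1) * z) * _ = 0)).resolve_left (mul_ne_zero hc hzρ)
    linear_combination e2 - e1
  rw [e3, mul_zero, add_zero] at e1
  exact e1

theorem eq_zero_of_form31_eq_zero {p q : Fin 4 → ℂ} (h : form31 p q = 0) (a b : ℂ) :
    cubicForm p a b = 0 ∧ cubicForm q a b = 0 := by
  constructor
  · simpa [eval_form31] using congrArg (eval ![a, b, 1, 0]) h
  · simpa [eval_form31] using congrArg (eval ![a, b, 0, 1]) h

theorem eq_zero_of_form13_eq_zero {r s : Fin 4 → ℂ} (h : form13 r s = 0) (a b : ℂ) :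
    cubicForm r a b = 0 ∧ cubicForm s a b = 0 := by
  constructor
  · simpa [eval_form13] using congrArg (eval ![1, 0, a, b]) h
  · simpa [eval_form13] using congrArg (eval ![0, 1, a, b]) h

/-- The quadratic argument works only at points where `F₃₁` and `F₁₃` are non-zero. Hence it is the
product of the three forms that vanishes everywhere, and smoothness along the two lines rules out
the first two factors. -/
theorem form22_eq_zero_of_symmetry {p q : Fin 4 → ℂ} {u v w : Fin 3 → ℂ} {r s : Fin 4 → ℂ}
    (h : ∀ x : Vec4, eval (B.toEquiv x) X.poly =
      eval x (form31 p q + form22 u v w + form13 r s))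
    (τ : X.Symmetry) (hfix : τ.fixP3 = l' ∪ l'') : form22 u v w = 0 := by
  obtain ⟨A, hA⟩ := τ.aut_mem
  have hlift : τ.IsLift A := fun z => by rw [← hA]; rfl
  obtain ⟨α, β, hα, hβ, hαβ, hAB⟩ := exists_scalars_of_fixP3_eq B τ hfix hlift
  have hinv : ∀ x, x ≠ 0 → eval x (form31 p q + form22 u v w + form13 r s) = 0 →
      eval ![α * x 0, α * x 1, β * x 2, β * x 3]
        (form31 p q + form22 u v w + form13 r s) = 0 := by
    intro x hx h0
    rw [← h, ← hAB]
    exact (hlift.map_mem_cone _ ⟨(map_ne_zero_iff _ B.toEquiv.injective).2 hx, by rw [h, h0]⟩).2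
  have hprod : form31 p q * form13 r s * form22 u v w = 0 := by
    refine MvPolynomial.funext fun x => ?_
    rw [map_mul, map_mul, map_zero, mul_eq_zero, mul_eq_zero, or_assoc]
    by_contra! hne
    refine hne.2.2 (middle_coeff_eq_zero_of_roots_stable (ρ := β / α) hne.1 hne.2.1
      (fun he => hαβ ((div_eq_one_iff_eq hα).1 he).symm) fun z hz => ?_)
    have hx : ![x 0, x 1, z * x 2, z * x 3] ≠ 0 := by
      intro hx
      have h0 : x 0 = 0 := congrFun hx 0
      have h1 : x 1 = 0 := congrFun hx 1
      exact hne.1 (by rw [eval_form31, h0, h1]; simp [cubicForm])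
    have h1 := hinv _ hx (by
      simp only [map_add, eval_form31, eval_form22, eval_form13, cubicForm, quadForm,
        Matrix.cons_val] at hz ⊢
      linear_combination z * hz)
    have hz0 : z ≠ 0 := by rintro rfl; exact hne.1 (by simpa using hz)
    -- The equation at the image point `(α x₀, α x₁, β z x₂, β z x₃)` is `α³ β z` times the
    -- quadratic at `(β / α) z`.
    refine (mul_eq_zero.1 (?_ : α ^ 3 * β * z * _ = 0)).resolve_left
      (mul_ne_zero (mul_ne_zero (pow_ne_zero 3 hα) hβ) hz0)
    obtain ⟨ρ, hρ⟩ : ∃ ρ, β / α = ρ := ⟨_, rfl⟩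
    have hβρ : β = α * ρ := by rw [← hρ]; field_simp
    rw [hρ]
    rw [hβρ] at h1 ⊢
    simp only [map_add, eval_form31, eval_form22, eval_form13, cubicForm, quadForm,
      Matrix.cons_val] at h1 ⊢
    linear_combination h1
  have hs := fun x hx => X.smooth_coordinates B.toEquiv h (x := x) hx
  rcases mul_eq_zero.1 hprod with h0 | h0
  · exfalso
    rcases mul_eq_zero.1 h0 with h0 | h0
    · obtain ⟨h1, h2⟩ := eq_zero_of_form31_eq_zero h0 1 0
      exact one_ne_zero (cubicForm_ne_zero_of_smooth31 hs h1 h2).1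
    · obtain ⟨h1, h2⟩ := eq_zero_of_form13_eq_zero h0 1 0
      exact one_ne_zero (cubicForm_ne_zero_of_smooth13 hs h1 h2).1
  · exact h0

end Symmetry

theorem mainTheorem3 (X : SmoothQuartic) (l' l'' : Set P3)
    (hl' : IsLine l') (hl'' : IsLine l'')
    (hX' : l' ⊆ X.surface) (hX'' : l'' ⊆ X.surface) (hdisj : Disjoint l' l'') :
    X.AreTwinLines l' l'' ↔
      ∃ τ : X.Symmetry, ¬ τ.IsSymplectic ∧ orderOf τ.onSurface = 2 ∧
        τ.fixX = l' ∪ l'' ∧ τ.fixP3 = l' ∪ l'' := by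
  obtain ⟨B⟩ := exists_adaptedCoordinates hl' hl'' hdisj
  obtain ⟨p, q, u, v, w, r, s, h⟩ := exists_bihomogeneous_form X B hX' hX''
  have hpq : ∀ a b : ℂ, cubicForm p a b = 0 → cubicForm q a b = 0 → a = 0 ∧ b = 0 :=
    fun a b => cubicForm_ne_zero_of_smooth31 fun x hx => X.smooth_coordinates B.toEquiv h hx
  constructor
  · rintro ⟨-, -, -, -, -, m, hinj, hm⟩
    obtain ⟨rfl, rfl, rfl⟩ := form22_coeff_eq_zero_of_lines B h hpq hinj fun i =>
      ⟨(hm i).1, (hm i).2.1, (hm i).2.2.2.2⟩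
    have h0 : form22 0 0 0 = 0 := by simp [form22, quadForm]
    rw [h0, add_zero] at h
    obtain ⟨hm1, hm2, -, -, hm3, hm4⟩ := hm 0
    exact exists_symmetry_of_bihomogeneous B hX' hX'' h hm1 hm2 hm3 hm4
  · rintro ⟨τ, -, -, -, hfix⟩
    rw [form22_eq_zero_of_symmetry B h τ hfix, add_zero] at h
    exact areTwinLines_of_bihomogeneous B hl' hl'' hX' hX'' hdisj h hpq

end
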